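/- Let $k$ be an algebraically closed field of characteristic $p>0$ and let $X$ be a proper smooth variety over $k$ (an integral scheme, proper and smooth over $k$), with canonical sheaf $\omega_{X/k}=\bigwedge^{\dim X}\Omega^1_{X/k}$. Let $\kappa(X)$ be its Kodaira dimension, that is, $\kappa(X)=\operatorname{tr.deg}_k\big(\bigoplus_{m\ge 0}H^0(X,\omega_{X/k}^{\otimes m})\big)-1$, with the convention $\kappa(X)=-\infty$ if $H^0(X,\omega_{X/k}^{\otimes m})=0$ for all $m\ge1$. If $\kappa(X)\ge 1$, then the absolute Frobenius $F_X\colon X\to X$ does not lift to $W_2(k)$, the ring of $p$-typical Witt vectors of length $2$: there do not exist a flat $W_2(k)$-scheme $\mathbf X$, an isomorphism of $k$-schemes $\mathbf X\times_{W_2(k)}k\cong X$, and a morphism of schemes $F_{\mathbf X}\colon\mathbf X\to\mathbf X$ such that $F_{\mathbf X}\circ i=i\circ F_X$, where $i\colon X\to\mathbf X$ is the induced closed immersion. -/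

import Mathlib

open CategoryTheory AlgebraicGeometry Opposite
open scoped KaehlerDifferential

universe u

noncomputable section

namespace FrobLift

/-! ### Top differential forms of algebras and their functoriality -/

section Algebra

variable (k : Type u) [CommRing k] (n : ℕ)

/-- `Ω^n_{A/k} = ⋀^n_A Ω_{A/k}`. -/
abbrev Forms (A : Type u) [CommRing A] [Algebra k A] : Type u := ⋀[A]^n (Ω[A⁄k])

/-- The symmetric algebra `⨁_m Sym^m_A(Ω^n_{A/k})`. Where `Ω^n_{A/k}` is an invertible module, the
degree `m` part `Sym^m_A(Ω^n_{A/k})` is the tensor power `(Ω^n_{A/k})^{⊗ m}`. -/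
abbrev PluriForms (A : Type u) [CommRing A] [Algebra k A] : Type u :=
  SymmetricAlgebra A (Forms k n A)

/-- The degree `m` part of `PluriForms k n A`, i.e. the `A`-span of the products of `m` elements
of `Ω^n_{A/k}`, as a `k`-module. -/
def pluriFormsDeg (A : Type u) [CommRing A] [Algebra k A] (m : ℕ) :
    Submodule k (PluriForms k n A) :=
  ((LinearMap.range (SymmetricAlgebra.ι A (Forms k n A))) ^ m).restrictScalars k

theorem one_mem_pluriFormsDeg (A : Type u) [CommRing A] [Algebra k A] :
    (1 : PluriForms k n A) ∈ pluriFormsDeg k n A 0 := by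
  rw [pluriFormsDeg, pow_zero, Submodule.restrictScalars_mem]
  exact Submodule.mem_one.mpr ⟨1, map_one _⟩

theorem mul_mem_pluriFormsDeg (A : Type u) [CommRing A] [Algebra k A] {i j : ℕ}
    {s t : PluriForms k n A} (hs : s ∈ pluriFormsDeg k n A i) (ht : t ∈ pluriFormsDeg k n A j) :
    s * t ∈ pluriFormsDeg k n A (i + j) := by
  rw [pluriFormsDeg, pow_add, Submodule.restrictScalars_mem]
  exact Submodule.mul_mem_mul hs ht

variable {A B : Type u} [CommRing A] [CommRing B] [Algebra k A] [Algebra k B]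

section

variable (A B) [Algebra A B] [IsScalarTower k A B]

/-- The alternating map `(ω₁, …, ωₙ) ↦ ω₁|_B ∧ ⋯ ∧ ωₙ|_B`. -/
def formsAlternating : (Ω[A⁄k]) [⋀^Fin n]→ₗ[A] (Forms k n B) :=
  { ((exteriorPower.ιMulti B n (M := Ω[B⁄k])).toMultilinearMap.restrictScalars A).compLinearMap
      (fun _ ↦ KaehlerDifferential.map k k A B) with
    map_eq_zero_of_eq' := fun v _ _ h hij ↦
      (exteriorPower.ιMulti B n (M := Ω[B⁄k])).map_eq_zero_of_eq
        (fun l ↦ KaehlerDifferential.map k k A B (v l)) (congrArg _ h) hij }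

/-- The map `Ω^n_{A/k} → Ω^n_{B/k}`, `a · dx₁ ∧ ⋯ ∧ dxₙ ↦ a · dx₁ ∧ ⋯ ∧ dxₙ`. -/
def formsMapAux : Forms k n A →ₗ[A] Forms k n B :=
  exteriorPower.alternatingMapLinearEquiv (formsAlternating k n A B)

/-- The map induced by `formsMapAux` on symmetric algebras. -/
def pluriFormsMapAux : PluriForms k n A →ₐ[A] PluriForms k n B :=
  SymmetricAlgebra.lift
    ((SymmetricAlgebra.ι B (Forms k n B)).restrictScalars A ∘ₗ formsMapAux k n A B)

end

/-- The pullback of pluri-forms along a homomorphism `φ : A → B` of `k`-algebras. -/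
def pluriFormsMap (φ : A →ₐ[k] B) : PluriForms k n A →ₐ[k] PluriForms k n B :=
  letI : Algebra A B := φ.toRingHom.toAlgebra
  haveI : IsScalarTower k A B := .of_algebraMap_eq' φ.comp_algebraMap.symm
  (pluriFormsMapAux k n A B).restrictScalars k

end Algebra

/-! ### The canonical ring and the Kodaira dimension -/

section Kodaira

variable {k : Type u} [Field k] {X : Scheme.{u}} (f : X ⟶ Spec (CommRingCat.of k))

theorem le_preimage_top (U : X.Opens) : U ≤ f ⁻¹ᵁ ⊤ := fun _ _ ↦ trivial

/-- The structure map `k → Γ(X, U)` of a `k`-scheme. -/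
def structMap (U : X.Opens) : k →+* Γ(X, U) :=
  (f.appLE ⊤ U (le_preimage_top f U)).hom.comp (Scheme.ΓSpecIso (CommRingCat.of k)).inv.hom

/-- `Γ(X, U)`, regarded as a `k`-algebra through `f`. -/
def Sec (_ : X ⟶ Spec (CommRingCat.of k)) (U : X.Opens) : Type u := Γ(X, U)

instance (U : X.Opens) : CommRing (Sec f U) := inferInstanceAs (CommRing Γ(X, U))

instance (U : X.Opens) : Algebra k (Sec f U) := (structMap f U).toAlgebra

/-- Restriction of functions, as a homomorphism of `k`-algebras. -/
def res {U V : X.Opens} (h : V ≤ U) : Sec f U →ₐ[k] Sec f V where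
  __ := (X.presheaf.map (homOfLE h).op).hom
  commutes' r := by
    change (f.appLE ⊤ U (le_preimage_top f U) ≫ X.presheaf.map (homOfLE h).op).hom _ = _
    rw [Scheme.Hom.appLE_map]
    rfl

/-- The function field of `X`, regarded as a `k`-algebra through `f`. -/
def FunField (_ : X ⟶ Spec (CommRingCat.of k)) [IsIntegral X] : Type u := X.functionField

instance [IsIntegral X] : Field (FunField f) := inferInstanceAs (Field X.functionField)

instance [IsIntegral X] : Algebra k (FunField f) :=
  ((X.presheaf.germ ⊤ (genericPoint X) trivial).hom.comp (structMap f ⊤)).toAlgebra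

/-- The rank of `Ω_{X/k}`, i.e. the dimension of its stalk at the generic point of `X`. If `X` is
smooth over `k`, this is the dimension of `X`. -/
def rankOmega [IsIntegral X] : ℕ := Module.finrank (FunField f) (Ω[FunField f⁄k])

/-- `H⁰(X, ω_{X/k}^{⊗ m})` for the canonical sheaf `ω_{X/k} = ⋀^n Ω_{X/k}`, `n` being the rank of
`Ω_{X/k}`: a section is given by its values on all affine open subschemes `U` of `X`, which are
elements of degree `m` of the symmetric algebra of the `Γ(X, U)`-module `Ω^n_{Γ(X, U)/k}` and are
compatible with restriction to smaller affine open subschemes. -/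
def pluricanonical [IsIntegral X] (m : ℕ) :
    Submodule k (∀ U : X.affineOpens, PluriForms k (rankOmega f) (Sec f U)) where
  carrier := {s | (∀ U : X.affineOpens, s U ∈ pluriFormsDeg k (rankOmega f) (Sec f U) m) ∧
    ∀ (U V : X.affineOpens) (h : (V : X.Opens) ≤ U),
      pluriFormsMap k (rankOmega f) (res f h) (s U) = s V}
  add_mem' hs ht := ⟨fun U ↦ add_mem (hs.1 U) (ht.1 U), fun U V h ↦ by
    simp only [Pi.add_apply, map_add, hs.2 U V h, ht.2 U V h]⟩
  zero_mem' := ⟨fun U ↦ zero_mem _, fun U V h ↦ by simp only [Pi.zero_apply, map_zero]⟩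
  smul_mem' c s hs := ⟨fun U ↦ Submodule.smul_mem _ c (hs.1 U), fun U V h ↦ by
    simp only [Pi.smul_apply, map_smul, hs.2 U V h]⟩

instance [IsIntegral X] : SetLike.GradedMonoid (pluricanonical f) where
  one_mem := ⟨fun _ ↦ one_mem_pluriFormsDeg _ _ _, fun _ _ _ ↦ map_one _⟩
  mul_mem _ _ s t hs ht := ⟨fun U ↦ mul_mem_pluriFormsDeg _ _ _ (hs.1 U) (ht.1 U), fun U V h ↦ by
    rw [Pi.mul_apply, Pi.mul_apply, map_mul, hs.2 U V h, ht.2 U V h]⟩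

/-- The canonical ring `R(X) = ⨁_{m ≥ 0} H⁰(X, ω_{X/k}^{⊗ m})`. -/
abbrev CanonicalRing [IsIntegral X] : Type u := DirectSum ℕ (fun m ↦ pluricanonical f m)

/-- The Kodaira dimension `κ(X) = tr.deg_k R(X) - 1`, with `κ(X) = -∞` if `R(X)` has transcendence
degree `0` over `k`, i.e. if `H⁰(X, ω_{X/k}^{⊗ m}) = 0` for all `m ≥ 1`. -/
def kodairaDim [IsIntegral X] : WithBot ℕ∞ :=
  if Algebra.trdeg k (CanonicalRing f) = 0 then ⊥
  else ((Cardinal.toENat (Algebra.trdeg k (CanonicalRing f)) - 1 : ℕ∞) : WithBot ℕ∞)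

end Kodaira

/-! ### The absolute Frobenius and its liftings to `W₂(k)` -/

section Frobenius

variable (p : ℕ) [Fact p.Prime]

/-- The `p`-power map of a commutative ring in which `p = 0`. -/
def powMap (R : Type u) [CommRing R] (h : (p : R) = 0) : R →+* R where
  toFun x := x ^ p
  map_one' := one_pow p
  map_mul' x y := mul_pow x y p
  map_zero' := zero_pow (Fact.out : p.Prime).ne_zero
  map_add' x y := by
    obtain ⟨r, hr⟩ := exists_add_pow_prime_eq (Fact.out : p.Prime) x y
    rw [hr, h]
    ring

theorem natCast_eq_zero (p : ℕ) {k : Type u} [Field k] [CharP k p] {X : Scheme.{u}}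
    (f : X ⟶ Spec (CommRingCat.of k)) (U : X.Opens) : (p : Γ(X, U)) = 0 := by
  rw [← map_natCast (structMap f U), CharP.cast_eq_zero, map_zero]

theorem truncatedWitt_surj (k : Type u) [CommRing k] (x : TruncatedWittVector p 2 k) :
    ∃ y : WittVector p k, WittVector.truncate 2 y = x :=
  WittVector.truncate_surjective p 2 k x

theorem coeff_zero_truncate (k : Type u) [CommRing k] (y : WittVector p k) :
    (WittVector.truncate 2 y).coeff 0 = WittVector.constantCoeff y :=
  WittVector.coeff_truncate y 0

/-- The ring homomorphism `W₂(k) → k`, `(x₀, x₁) ↦ x₀`. -/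
def wittResidue (k : Type u) [CommRing k] : TruncatedWittVector p 2 k →+* k where
  toFun x := x.coeff 0
  map_one' := by
    rw [← map_one (WittVector.truncate (p := p) 2), coeff_zero_truncate, map_one]
  map_mul' x y := by
    obtain ⟨x, rfl⟩ := truncatedWitt_surj p k x
    obtain ⟨y, rfl⟩ := truncatedWitt_surj p k y
    rw [← map_mul, coeff_zero_truncate, coeff_zero_truncate, coeff_zero_truncate, map_mul]
  map_zero' := by
    rw [← map_zero (WittVector.truncate (p := p) 2), coeff_zero_truncate, map_zero]
  map_add' x y := by
    obtain ⟨x, rfl⟩ := truncatedWitt_surj p k x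
    obtain ⟨y, rfl⟩ := truncatedWitt_surj p k y
    rw [← map_add, coeff_zero_truncate, coeff_zero_truncate, coeff_zero_truncate, map_add]

variable {k : Type u} [Field k] [CharP k p] {X : Scheme.{u}} (f : X ⟶ Spec (CommRingCat.of k))

/-- The `p`-power endomorphism of the ringed space underlying a `k`-scheme `X`: the identity on the
topological space and `s ↦ s ^ p` on the structure sheaf. -/
def absFrobeniusAux : X.toPresheafedSpace ⟶ X.toPresheafedSpace where
  base := 𝟙 _
  c := { app := fun U ↦ CommRingCat.ofHom (powMap p Γ(X, U.unop) (natCast_eq_zero p f U.unop))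
         naturality := by
          intro U V i
          ext s
          exact (map_pow (X.presheaf.map i).hom s p).symm }

/-- The absolute Frobenius `F_X : X → X` of a `k`-scheme. -/
def absFrobenius : X ⟶ X where
  toHom := absFrobeniusAux p f
  prop x := by
    refine ⟨fun a ha ↦ ?_⟩
    obtain ⟨U, hxU, s, rfl⟩ := X.presheaf.exists_germ_eq a
    have h1 := PresheafedSpace.stalkMap_germ_apply (absFrobeniusAux p f) U x hxU s
    have h2 : IsUnit ((X.presheaf.germ U x hxU).hom ((s : Γ(X, U)) ^ p)) := by
      have h3 := ha
      erw [h1] at h3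
      exact h3
    rw [map_pow] at h2
    exact (isUnit_pow_iff (Fact.out : p.Prime).ne_zero).mp h2

/-- The Frobenius of `X` lifts to `W₂(k)`: there are a flat lifting `Y` of `X` to `W₂(k)`, i.e. a
flat `W₂(k)`-scheme together with an identification `Y ×_{W₂(k)} k ≅ X` of `k`-schemes, and a
morphism `F_Y : Y → Y` with `F_Y ∘ i = i ∘ F_X` for the induced closed immersion `i : X → Y`. -/
def FrobeniusLifts : Prop :=
  ∃ (Y : Scheme.{u}) (g : Y ⟶ Spec (CommRingCat.of (TruncatedWittVector p 2 k))) (i : X ⟶ Y)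
    (FY : Y ⟶ Y),
    Flat g ∧ IsPullback i f g (Spec.map (CommRingCat.ofHom (wittResidue p k))) ∧
      i ≫ FY = absFrobenius p f ≫ i

end Frobenius

end FrobLift

end

/-! A lifting `F` of Frobenius satisfies `F b = b ^ p + p * c`, and since the lifting of `X` is
flat, `c` is well defined modulo `p`; write `δ b` for its class. Dividing the differential of `F` by
`p` gives the Frobenius-semilinear map `dF/p : da ↦ a ^ (p - 1) da + dδ(ã)` on `Ω_X`, with `ã` any
lifting of `a` (`LiftData.der`, `LiftData.isFrobDer_der`).

This map is injective at the generic point. If the `dxᵢ` form a basis of the differentials of the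
function field `K`, the images `xᵢ ^ (p - 1) dxᵢ + dyᵢ` are again independent
(`det_pow_smul_add_ne_zero`). The Cartier operator, which sends them to `dxᵢ`, would show this; here
it is replaced by a grading of `K` by `(ℤ/p)ⁿ` coming from the logarithmic derivations `xⱼ ∂ⱼ`, in
which the relevant determinant has degree `0` part `1`.

So `h = det (dF/p)` is a nonzero rational function once a basis of `Ω_K` is fixed, and it represents
a nonzero global section of `ω ^ (1 - p)`. If `s` is a section of `ω ^ m` with generic value `a`,
then `a ^ (p - 1) * h ^ m` is regular everywhere (`exists_eq_pow_mul_pow`), hence constant because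
`X` is proper and integral over an algebraically closed field (`exists_pow_mul_pow_eq`).

Evaluation at the generic point embeds the canonical ring into `K[T]`, a form of degree `m` going to
`a T ^ m` (`canonicalToPoly_injective`). By the above, each such monomial is integral over `k[τ]`
with `τ = h⁻¹ T ^ (p - 1)`. The canonical ring therefore has transcendence degree at most `1`, and
`κ(X) ≤ 0`. -/

noncomputable section

namespace FrobLift

/-! ### Multiplication by `p` in `W₂(k)`. -/

section Witt

variable (p : ℕ) [Fact p.Prime] (k : Type u) [CommRing k] [CharP k p]

theorem coeff_zero_natCast_mul (y : TruncatedWittVector p 2 k) :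
    ((p : TruncatedWittVector p 2 k) * y).coeff 0 = 0 := by
  obtain ⟨y, rfl⟩ := truncatedWitt_surj p k y
  rw [← map_natCast (WittVector.truncate (p := p) 2), ← map_mul, mul_comm,
    WittVector.coeff_truncate]
  exact WittVector.mul_charP_coeff_zero y

theorem coeff_one_natCast_mul (y : TruncatedWittVector p 2 k) :
    ((p : TruncatedWittVector p 2 k) * y).coeff 1 = y.coeff 0 ^ p := by
  obtain ⟨y, rfl⟩ := truncatedWitt_surj p k y
  rw [← map_natCast (WittVector.truncate (p := p) 2), ← map_mul, mul_comm,
    WittVector.coeff_truncate, WittVector.coeff_truncate]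
  exact WittVector.mul_charP_coeff_succ y 0

/-- Since `p * (y₀, y₁) = (0, y₀ ^ p)`, a vector `(0, x₁)` is a multiple of `p` as soon as `x₁` has
a `p`-th root. -/
theorem wittResidue_eq_zero_iff [PerfectRing k p] (x : TruncatedWittVector p 2 k) :
    wittResidue p k x = 0 ↔ ∃ y, x = p * y := by
  constructor
  · intro h
    obtain ⟨c, hc⟩ := surjective_frobenius k p (x.coeff 1)
    refine ⟨TruncatedWittVector.mk p fun _ ↦ c, TruncatedWittVector.ext fun i ↦ ?_⟩
    fin_cases i
    · exact h.trans (coeff_zero_natCast_mul p k _).symm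
    · refine Eq.trans ?_ (coeff_one_natCast_mul p k _).symm
      rw [TruncatedWittVector.coeff_mk]
      exact hc.symm
  · rintro ⟨y, rfl⟩
    exact coeff_zero_natCast_mul p k y

theorem wittResidue_eq_zero_of_natCast_mul_eq_zero [IsReduced k] (x : TruncatedWittVector p 2 k)
    (h : (p : TruncatedWittVector p 2 k) * x = 0) : wittResidue p k x = 0 := by
  have h1 := coeff_one_natCast_mul p k x
  rw [h, TruncatedWittVector.coeff_zero] at h1
  exact eq_zero_of_pow_eq_zero h1.symm

theorem natCast_mul_natCast_eq_zero :
    (p : TruncatedWittVector p 2 k) * (p : TruncatedWittVector p 2 k) = 0 := by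
  refine TruncatedWittVector.ext fun i ↦ ?_
  rw [TruncatedWittVector.coeff_zero]
  fin_cases i
  · exact coeff_zero_natCast_mul p k _
  · refine (coeff_one_natCast_mul p k _).trans ?_
    have := coeff_zero_natCast_mul p k 1
    rw [mul_one] at this
    rw [this, zero_pow (Fact.out : p.Prime).ne_zero]

end Witt

/-! ### The polynomial measuring the failure of additivity of `x ↦ x ^ p`. -/

section FrobeniusPolynomial

variable (p : ℕ) [hp : Fact p.Prime]

theorem exists_frobPoly : ∃ r : MvPolynomial (Fin 2) ℤ,
    (MvPolynomial.X 0 + MvPolynomial.X 1) ^ p =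
      MvPolynomial.X 0 ^ p + MvPolynomial.X 1 ^ p + (p : MvPolynomial (Fin 2) ℤ) * r := by
  obtain ⟨r, hr⟩ := exists_add_pow_prime_eq hp.out (MvPolynomial.X 0 : MvPolynomial (Fin 2) ℤ)
    (MvPolynomial.X 1)
  exact ⟨MvPolynomial.X 0 * MvPolynomial.X 1 * r, by rw [hr]; ring⟩

/-- The polynomial `((x + y) ^ p - x ^ p - y ^ p) / p`. -/
def frobPoly : MvPolynomial (Fin 2) ℤ := (exists_frobPoly p).choose

theorem frobPoly_spec : (MvPolynomial.X 0 + MvPolynomial.X 1) ^ p =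
    MvPolynomial.X 0 ^ p + MvPolynomial.X 1 ^ p + (p : MvPolynomial (Fin 2) ℤ) * frobPoly p :=
  (exists_frobPoly p).choose_spec

/-- The defining identity is differentiated over `ℤ`, where `p` can be cancelled. The result can
then be evaluated in characteristic `p`, where the identity itself no longer determines `frobPoly`.
-/
theorem pderiv_frobPoly (i : Fin 2) : MvPolynomial.pderiv i (frobPoly p) =
    (MvPolynomial.X 0 + MvPolynomial.X 1) ^ (p - 1) - MvPolynomial.X i ^ (p - 1) := by
  have hp0 : (p : MvPolynomial (Fin 2) ℤ) ≠ 0 := Nat.cast_ne_zero.mpr hp.out.ne_zero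
  have h := congrArg (MvPolynomial.pderiv i) (frobPoly_spec p)
  refine mul_left_cancel₀ hp0 ?_
  simp only [map_add, Derivation.leibniz_pow, Derivation.leibniz, Derivation.map_natCast,
    MvPolynomial.pderiv_X, smul_eq_mul, nsmul_eq_mul, mul_zero, add_zero] at h
  obtain rfl | rfl : i = 0 ∨ i = 1 := by omega
  all_goals
    simp at h
    linear_combination -h

variable {p} {A : Type*} [CommRing A]

theorem derivation_aeval {R M σ : Type*} [Finite σ] [CommRing R] [Algebra R A]
    [AddCommGroup M] [Module A M] [Module R M]
    (d : Derivation R A M) (f : Fin 2 → A) (P : MvPolynomial (Fin 2) ℤ) :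
    d (MvPolynomial.aeval f P) =
      ∑ i, MvPolynomial.aeval f (MvPolynomial.pderiv i P) • d (f i) := by
  induction P using MvPolynomial.induction_on with
  | C a => simp
  | add P Q hP hQ => simp only [map_add, hP, hQ, add_smul, Finset.sum_add_distrib]
  | mul_X P j h =>
    simp only [map_mul, MvPolynomial.aeval_X, Derivation.leibniz, h, MvPolynomial.pderiv_X,
      smul_eq_mul, map_add, add_smul, Finset.sum_add_distrib, Finset.smul_sum, smul_smul]
    congr 1
    rw [Finset.sum_eq_single j]
    · simp
    · intro b _ hb
      simp [hb.symm]
    · simp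

theorem derivation_frobPoly {R M : Type*} [CommRing R] [Algebra R A]
    [AddCommGroup M] [Module A M] [Module R M] (d : Derivation R A M) (x y : A) :
    d (MvPolynomial.aeval ![x, y] (frobPoly p)) =
      (x + y) ^ (p - 1) • d (x + y) - x ^ (p - 1) • d x - y ^ (p - 1) • d y := by
  rw [derivation_aeval (σ := Fin 2)]
  simp only [pderiv_frobPoly, Fin.sum_univ_two, map_sub, map_pow, map_add, MvPolynomial.aeval_X,
    Matrix.cons_val_zero, Matrix.cons_val_one, sub_smul, smul_add]
  abel

theorem add_pow_eq_frobPoly (x y : A) :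
    (x + y) ^ p = x ^ p + y ^ p + p * MvPolynomial.aeval ![x, y] (frobPoly p) := by
  simpa using congrArg (MvPolynomial.aeval ![x, y]) (frobPoly_spec p)

end FrobeniusPolynomial

/-! ### The divided differential `dF/p` of a Frobenius lifting, for rings. -/

/-- A Frobenius derivation `A → M`, i.e. a derivation into the restriction of scalars of `M` along
the `p`-power map. -/
structure IsFrobDer (p : ℕ) {A M : Type*} [CommRing A] [AddCommGroup M] [Module A M]
    (D : A → M) : Prop where
  map_add : ∀ a b, D (a + b) = D a + D b
  map_mul : ∀ a b, D (a * b) = a ^ p • D b + b ^ p • D a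

/-- A lifting `B` of `A` modulo `p ^ 2`, together with a lifting of the Frobenius. -/
structure LiftData (p : ℕ) (B A : Type*) [CommRing B] [CommRing A] where
  proj : B →+* A
  frob : B →+* B
  proj_surjective : Function.Surjective proj
  proj_eq_zero_iff : ∀ b, proj b = 0 ↔ ∃ c, b = p * c
  proj_eq_zero_of_mul : ∀ b, (p : B) * b = 0 → proj b = 0
  mul_self : (p : B) * p = 0
  proj_frob : ∀ b, proj (frob b) = proj b ^ p

namespace LiftData

variable {p : ℕ} [hp : Fact p.Prime] {B A : Type*} [CommRing B] [CommRing A] (L : LiftData p B A)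
include L

omit hp in
theorem natCast_eq_zero : (p : A) = 0 := by
  have := (L.proj_eq_zero_iff p).mpr ⟨1, (mul_one _).symm⟩
  rwa [map_natCast] at this

omit hp in
theorem exists_frob_eq (b : B) : ∃ c, L.frob b = b ^ p + p * c := by
  obtain ⟨c, hc⟩ := (L.proj_eq_zero_iff (L.frob b - b ^ p)).mp
    (by rw [map_sub, L.proj_frob, map_pow, sub_self])
  exact ⟨c, by rw [← hc]; ring⟩

/-- The map `b ↦ (F b - b ^ p) / p`. -/
def δ (b : B) : A := L.proj (L.exists_frob_eq b).choose

-- Two choices of `c` differ by an element killed by `p`, and `proj_eq_zero_of_mul`, the remnant of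
-- flatness over `W₂(k)`, makes it vanish in `A`.
omit hp in
theorem δ_eq {b c : B} (h : L.frob b = b ^ p + p * c) : L.δ b = L.proj c := by
  rw [← sub_eq_zero, δ, ← map_sub]
  apply L.proj_eq_zero_of_mul
  have := (L.exists_frob_eq b).choose_spec
  linear_combination h - this

/-- The correction term is the one whose differential, by `derivation_frobPoly`, compensates the
non-additivity of `a ↦ a ^ (p - 1) da`. -/
theorem δ_add (x y : B) : L.δ (x + y) = L.δ x + L.δ y -
    MvPolynomial.aeval ![L.proj x, L.proj y] (frobPoly p) := by
  obtain ⟨c, hc⟩ := L.exists_frob_eq x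
  obtain ⟨c', hc'⟩ := L.exists_frob_eq y
  rw [L.δ_eq hc, L.δ_eq hc', L.δ_eq (c := c + c' - MvPolynomial.aeval ![x, y] (frobPoly p))]
  · rw [map_sub, map_add]
    congr 1
    refine (MvPolynomial.comp_aeval_apply L.proj.toIntAlgHom (f := ![x, y]) _).trans ?_
    congr 2
    funext i
    fin_cases i <;> rfl
  · rw [map_add, hc, hc', add_pow_eq_frobPoly]
    ring

omit hp in
theorem δ_mul (x y : B) :
    L.δ (x * y) = L.proj x ^ p * L.δ y + L.proj y ^ p * L.δ x := by
  obtain ⟨c, hc⟩ := L.exists_frob_eq x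
  obtain ⟨c', hc'⟩ := L.exists_frob_eq y
  rw [L.δ_eq hc, L.δ_eq hc', L.δ_eq (c := x ^ p * c' + y ^ p * c)]
  · simp
  · rw [map_mul, hc, hc']
    linear_combination c * c' * L.mul_self

/-- As `p ^ 2 = 0`, adding `p * c` does not change the `p`-th power, while `F` adds `p * F c = p * c
^ p`. Changing the lifting thus alters `δ` by a `p`-th power, which `d` kills. -/
theorem δ_add_mul (x c : B) : L.δ (x + p * c) = L.δ x + L.proj c ^ p := by
  obtain ⟨e, he⟩ := L.exists_frob_eq x
  obtain ⟨e', he'⟩ := L.exists_frob_eq c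
  rw [L.δ_eq he, L.δ_eq (c := e + c ^ p)]
  · simp
  · have h1 : (x + p * c) ^ p = x ^ p := by
      have h2 : (p : B) ∣ p * c := ⟨c, rfl⟩
      obtain ⟨r, hr⟩ := exists_add_pow_prime_eq hp.out x (p * c)
      obtain ⟨q, hq⟩ : ∃ q, p = q + 2 := ⟨p - 2, by have := hp.out.two_le; omega⟩
      have h3 : ((p : B) * c) ^ p = 0 := by
        conv_lhs => rw [show ((p : B) * c) ^ p = ((p : B) * c) ^ (q + 2) by rw [← hq]]
        linear_combination ((p : B) * c) ^ q * c ^ 2 * L.mul_self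
      rw [hr, h3]
      linear_combination x * c * r * L.mul_self
    rw [map_add, map_mul, map_natCast, he, he', h1]
    linear_combination e' * L.mul_self

variable (k : Type*) [CommRing k] [Algebra k A]

open KaehlerDifferential

omit L hp in
theorem d_pow_eq_zero (h : (p : A) = 0) (a : A) : D k A (a ^ p) = 0 := by
  rw [Derivation.leibniz_pow, ← Nat.cast_smul_eq_nsmul A, h, zero_smul]

theorem d_δ_congr {b b' : B} (h : L.proj b = L.proj b') : D k A (L.δ b) = D k A (L.δ b') := by
  obtain ⟨c, hc⟩ := (L.proj_eq_zero_iff (b - b')).mp (by rw [map_sub, h, sub_self])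
  rw [show b = b' + p * c by rw [← hc]; ring, L.δ_add_mul, map_add,
    d_pow_eq_zero k L.natCast_eq_zero, add_zero]

/-- The Frobenius derivation `dF / p : a ↦ a ^ (p - 1) da + dδ(a)`. -/
def der (a : A) : Ω[A⁄k] :=
  a ^ (p - 1) • D k A a + D k A (L.δ (L.proj_surjective a).choose)

theorem der_proj (b : B) :
    L.der k (L.proj b) = L.proj b ^ (p - 1) • D k A (L.proj b) + D k A (L.δ b) := by
  rw [der, L.d_δ_congr k (L.proj_surjective (L.proj b)).choose_spec]

theorem isFrobDer_der : IsFrobDer p (L.der k) where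
  map_add a b := by
    obtain ⟨a, rfl⟩ := L.proj_surjective a
    obtain ⟨b, rfl⟩ := L.proj_surjective b
    rw [← map_add, L.der_proj, L.der_proj, L.der_proj, L.δ_add, map_sub, derivation_frobPoly,
      map_add L.proj, map_add, map_add (D k A)]
    abel
  map_mul a b := by
    obtain ⟨a, rfl⟩ := L.proj_surjective a
    obtain ⟨b, rfl⟩ := L.proj_surjective b
    obtain ⟨q, hq⟩ : ∃ q, p = q + 1 := ⟨p - 1, by have := hp.out.two_le; omega⟩
    rw [← map_mul, L.der_proj, L.der_proj, L.der_proj, L.δ_mul, map_mul L.proj, map_add]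
    simp only [Derivation.leibniz, d_pow_eq_zero k L.natCast_eq_zero, smul_zero, add_zero]
    have h1 : p - 1 = q := by omega
    rw [h1]
    simp only [smul_add, smul_smul, mul_pow]
    have h2 : ∀ a : A, a ^ p = a ^ q * a := fun a ↦ by rw [← pow_succ, ← hq]
    rw [h2, h2]
    ring_nf
    abel

/-- Compatibility of `dF / p` with homomorphisms. -/
theorem map_der {B' A' : Type*} [CommRing B'] [CommRing A'] (L' : LiftData p B' A')
    [Algebra k A'] [Algebra A A'] [IsScalarTower k A A'] (β : B →+* B')
    (h1 : ∀ b, L'.proj (β b) = algebraMap A A' (L.proj b))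
    (h2 : ∀ b, L'.frob (β b) = β (L.frob b)) (a : A) :
    L'.der k (algebraMap A A' a) = KaehlerDifferential.map k k A A' (L.der k a) := by
  obtain ⟨b, rfl⟩ := L.proj_surjective a
  obtain ⟨c, hc⟩ := L.exists_frob_eq b
  rw [← h1, L'.der_proj, L.der_proj, L.δ_eq hc, L'.δ_eq (c := β c), h1, h1, map_add, map_smul,
    map_D, map_D, ← map_pow, algebraMap_smul]
  rw [h2, hc, map_add, map_mul, map_pow, map_natCast]

end LiftData

/-! ### Generic independence of the forms `xᵢ ^ (p - 1) dxᵢ + dyᵢ`. -/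

section Homogeneous

open KaehlerDifferential Module

variable {p : ℕ} [hp : Fact p.Prime] {k K ι : Type*} [Field k] [Field K] [CharP K p] [Algebra k K]
  (θ : ι → Derivation k K K)

/-- The homogeneous elements of degree `α` for a family of derivations. -/
def homog (α : ι → ZMod p) : Submodule k K where
  carrier := {u | ∀ j, θ j u = ZMod.castHom (dvd_refl p) K (α j) * u}
  add_mem' ha hb j := by rw [map_add, ha j, hb j, mul_add]
  zero_mem' j := by rw [map_zero, mul_zero]
  smul_mem' c x hx j := by rw [Derivation.map_smul, hx j, mul_smul_comm]

variable {θ}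

theorem homog_mul {α β : ι → ZMod p} {u v : K} (hu : u ∈ homog θ α) (hv : v ∈ homog θ β) :
    u * v ∈ homog θ (α + β) := fun j ↦ by
  rw [Derivation.leibniz, hu j, hv j, Pi.add_apply, map_add, smul_eq_mul, smul_eq_mul]
  ring

theorem homog_one : (1 : K) ∈ homog θ (0 : ι → ZMod p) := fun j ↦ by simp

theorem homog_algebraMap_zmod (a : ZMod p) :
    ZMod.castHom (dvd_refl p) K a ∈ homog θ (0 : ι → ZMod p) := fun j ↦ by
  obtain ⟨n, rfl⟩ := ZMod.natCast_zmod_surjective a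
  simp

theorem homog_prod {κ : Type*} (s : Finset κ) (α : κ → ι → ZMod p) (u : κ → K)
    (h : ∀ i ∈ s, u i ∈ homog θ (α i)) : ∏ i ∈ s, u i ∈ homog θ (∑ i ∈ s, α i) := by
  classical
  induction s using Finset.induction_on with
  | empty => simpa using homog_one
  | insert a s ha ih =>
    rw [Finset.prod_insert ha, Finset.sum_insert ha]
    exact homog_mul (h a (by simp)) (ih fun i hi ↦ h i (by simp [hi]))

theorem homog_pow_char (a : K) : a ^ p ∈ homog θ (0 : ι → ZMod p) := fun j ↦ by
  simp [Derivation.leibniz_pow]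

variable (p θ) in
/-- The projection onto the homogeneous elements of degree `0`. -/
def homogProj [Fintype ι] : Module.End k K :=
  (Finset.univ.toList.map fun j ↦ 1 - (θ j : Module.End k K) ^ (p - 1)).prod

/-- The scalars produced by the factors already applied are constants for all `θ i`, so the next
factor still acts on the product by its own scalar. -/
theorem list_prod_apply_eq (l : List ι) (f : ι → Module.End k K) (c : ι → K) (u : K)
    (h : ∀ j (a : K), (∀ i, θ i a = 0) → f j (a * u) = c j * a * u)
    (hc : ∀ i j, θ i (c j) = 0) : (l.map f).prod u = (l.map c).prod * u ∧
      ∀ i, θ i (l.map c).prod = 0 := by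
  induction l with
  | nil => simp
  | cons a l ih =>
    refine ⟨?_, fun i ↦ ?_⟩
    · rw [List.map_cons, List.prod_cons, Module.End.mul_apply, ih.1, h a _ ih.2, List.map_cons,
        List.prod_cons]
    · rw [List.map_cons, List.prod_cons, Derivation.leibniz, ih.2, hc]
      simp

theorem homogProj_apply [Fintype ι] {α : ι → ZMod p} {u : K} (hu : u ∈ homog θ α) :
    homogProj p θ u = (Finset.univ.toList.map fun j ↦
      ZMod.castHom (dvd_refl p) K (1 - α j ^ (p - 1))).prod * u := by
  refine (list_prod_apply_eq (θ := θ) _ _ _ u (fun j a ha ↦ ?_) fun i j ↦ ?_).1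
  · have : ∀ n : ℕ, ((θ j : Module.End k K) ^ n) (a * u) =
        ZMod.castHom (dvd_refl p) K (α j ^ n) * (a * u) := by
      intro n
      induction n with
      | zero => simp
      | succ n ih =>
        rw [pow_succ', Module.End.mul_apply, ih]
        change θ j _ = _
        rw [Derivation.leibniz, Derivation.leibniz, ha j, hu j,
          homog_algebraMap_zmod (θ := θ) (α j ^ n) j]
        simp only [Pi.zero_apply, map_zero, smul_eq_mul, map_pow]
        ring
    rw [LinearMap.sub_apply, Module.End.one_apply, this, map_sub, map_one]
    ring
  · rw [homog_algebraMap_zmod (θ := θ) _ i]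
    simp

/-- By Fermat, `1 - α j ^ (p - 1)` is zero at any `j` with `α j ≠ 0`. -/
theorem homogProj_of_ne [Fintype ι] {α : ι → ZMod p} {u : K} (hu : u ∈ homog θ α) (hα : α ≠ 0) :
    homogProj p θ u = 0 := by
  obtain ⟨j, hj⟩ := Function.ne_iff.mp hα
  rw [homogProj_apply hu, List.prod_eq_zero, zero_mul]
  rw [List.mem_map]
  exact ⟨j, by simp, by rw [ZMod.pow_card_sub_one_eq_one hj, sub_self, map_zero]⟩

theorem homogProj_one [Fintype ι] : homogProj p θ (1 : K) = 1 := by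
  rw [homogProj_apply (homog_one (p := p)), mul_one]
  refine List.prod_eq_one fun x hx ↦ ?_
  obtain ⟨j, -, rfl⟩ := List.mem_map.mp hx
  have := hp.out.two_le
  rw [Pi.zero_apply, zero_pow (by omega), sub_zero, map_one]

/-- The degree `0` part of `det (1 + θ u)` is `1`. -/
theorem homogProj_det [Fintype ι] [DecidableEq ι] (c : ι → (ι → ZMod p) → K)
    (hc : ∀ i α, c i α ∈ homog θ α) :
    homogProj p θ (Matrix.det (Matrix.of fun i j ↦
      (1 : Matrix ι ι K) i j + θ j (∑ α, c i α))) = 1 := by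
  -- Row `i` of the matrix is a sum of multiples of constant rows: `none` is the unit row `i` with
  -- weight `1` in degree `0`, and `some α` is the row `α` with weight `c i α`, because `θ j (c i α)
  -- = α j * c i α`. The determinant is expanded multilinearly over these choices.
  let deg : Option (ι → ZMod p) → ι → ZMod p := fun o ↦ o.elim 0 id
  let row : ι → Option (ι → ZMod p) → ι → ZMod p := fun i o ↦ o.elim (Pi.single i 1) id
  let wt : ι → Option (ι → ZMod p) → K := fun i o ↦ o.elim 1 (c i)
  have hwt : ∀ i o, wt i o ∈ homog θ (deg o) := fun i o ↦ by
    cases o with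
    | none => exact homog_one
    | some α => exact hc i α
  let φ := ZMod.castHom (dvd_refl p) K
  have hrow : (Matrix.of fun i j ↦ (1 : Matrix ι ι K) i j + θ j (∑ α, c i α)) =
      fun i ↦ ∑ o, fun j ↦ wt i o * φ (row i o j) := by
    ext i j
    rw [Finset.sum_apply, Fintype.sum_option, Matrix.of_apply, map_sum]
    congr 1
    · simp [wt, row, Pi.single_apply, Matrix.one_apply, eq_comm]
    · exact Finset.sum_congr rfl fun α _ ↦ (hc i α j).trans (mul_comm _ _)
  have hexp : Matrix.det (Matrix.of fun i j ↦ (1 : Matrix ι ι K) i j + θ j (∑ α, c i α)) =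
      ∑ r : ι → Option (ι → ZMod p), (∏ i, wt i (r i)) *
        φ (Matrix.det (Matrix.of fun i ↦ row i (r i))) := by
    rw [hrow]
    refine ((Matrix.detRowAlternating (R := K) (n := ι)).toMultilinearMap.map_sum
      (fun i o j ↦ wt i o * φ (row i o j))).trans (Finset.sum_congr rfl fun r _ ↦ ?_)
    rw [RingHom.map_det]
    exact Matrix.det_mul_column (fun i ↦ wt i (r i))
      (φ.mapMatrix (Matrix.of fun i ↦ row i (r i)))
  rw [hexp, map_sum, Finset.sum_eq_single (fun _ ↦ none)]
  · have : (Matrix.of fun i ↦ row i none) = 1 := by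
      ext i j
      simp [row, Pi.single_apply, Matrix.one_apply, eq_comm]
    rw [this, Matrix.det_one, map_one, mul_one, Finset.prod_congr rfl fun i _ ↦ rfl]
    simp only [wt, Option.elim_none, Finset.prod_const_one]
    exact homogProj_one
  · intro r _ hr
    by_cases h0 : ∑ i, deg (r i) = 0
    -- In total degree `0` the rows chosen as `some α` add up to zero. There is at least one of
    -- them, so they give a linear relation and the term vanishes.
    · have : Matrix.det (Matrix.of fun i ↦ row i (r i)) = 0 := by
        refine Matrix.exists_vecMul_eq_zero_iff.mp ⟨fun i ↦ (r i).elim 0 1, ?_, ?_⟩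
        · obtain ⟨i, hi⟩ := Function.ne_iff.mp hr
          refine Function.ne_iff.mpr ⟨i, ?_⟩
          obtain ⟨α, hα⟩ := Option.ne_none_iff_exists'.mp hi
          simp [hα]
        · rw [← h0]
          ext j
          rw [Matrix.vecMul, dotProduct, Finset.sum_apply]
          refine Finset.sum_congr rfl fun i _ ↦ ?_
          cases h : r i <;> simp [h, deg, row]
      rw [this, map_zero, mul_zero, map_zero]
    · refine homogProj_of_ne (α := ∑ i, deg (r i)) ?_ h0
      have := homog_mul (homog_prod Finset.univ _ _ fun i _ ↦ hwt i (r i))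
        (homog_algebraMap_zmod (θ := θ) (Matrix.det (Matrix.of fun i ↦ row i (r i))))
      rwa [add_zero] at this
  · simp

theorem iSup_homog_mul {a b : K} (ha : a ∈ (⨆ α : ι → ZMod p, homog θ α : Submodule k K))
    (hb : b ∈ (⨆ α : ι → ZMod p, homog θ α : Submodule k K)) :
    a * b ∈ (⨆ α : ι → ZMod p, homog θ α : Submodule k K) := by
  have h : (⨆ α : ι → ZMod p, homog θ α) * (⨆ α : ι → ZMod p, homog θ α) ≤
      ⨆ α : ι → ZMod p, homog θ α := by
    rw [Submodule.iSup_mul]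
    refine iSup_le fun α ↦ ?_
    rw [Submodule.mul_iSup]
    refine iSup_le fun β ↦ Submodule.mul_le.mpr fun u hu v hv ↦ ?_
    exact Submodule.mem_iSup_of_mem (α + β) (homog_mul hu hv)
  exact h (Submodule.mul_mem_mul ha hb)

variable (p θ) in
/-- The subfield of sums of homogeneous elements. -/
def homogField : IntermediateField k K where
  carrier := (⨆ α : ι → ZMod p, homog θ α : Submodule k K)
  add_mem' := add_mem
  mul_mem' {a b} ha hb := by
    exact iSup_homog_mul ha hb
  algebraMap_mem' r := Submodule.mem_iSup_of_mem 0 fun j ↦ by simp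
  inv_mem' a ha := by
    have h : ∀ n : ℕ, a ^ n ∈ (⨆ α : ι → ZMod p, homog θ α : Submodule k K) := fun n ↦ by
      induction n with
      | zero => exact Submodule.mem_iSup_of_mem 0 (by rw [pow_zero]; exact homog_one)
      | succ n ih => rw [pow_succ]; exact iSup_homog_mul ih ha
    -- Inverses come for free, since every `p`-th power is homogeneous of degree `0`.
    have h1 : a⁻¹ = a ^ (p - 1) * a⁻¹ ^ p := by
      by_cases h0 : a = 0
      · rw [h0, inv_zero, zero_pow hp.out.ne_zero, mul_zero]
      · obtain ⟨q, hq⟩ : ∃ q, p = q + 1 := ⟨p - 1, by have := hp.out.two_le; omega⟩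
        have h2 : p - 1 = q := by omega
        rw [h2, inv_pow]
        conv_rhs => rw [show a ^ p = a ^ (q + 1) by rw [← hq]]
        field_simp
        ring
    rw [h1]
    exact iSup_homog_mul (h _) (Submodule.mem_iSup_of_mem 0 (homog_pow_char _))

theorem mem_homogField_iff (a : K) :
    a ∈ homogField p θ ↔ a ∈ (⨆ α : ι → ZMod p, homog θ α : Submodule k K) := Iff.rfl

/-- The logarithmic derivations `xⱼ ∂ⱼ` attached to a basis `dxⱼ` of the differentials. -/
def logDer (x : ι → K) (e : Basis ι K (Ω[K⁄k])) (j : ι) : Derivation k K K :=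
  (x j • e.coord j).compDer (D k K)

theorem logDer_apply (x : ι → K) (e : Basis ι K (Ω[K⁄k])) (j : ι) (a : K) :
    logDer x e j a = x j * e.repr (D k K a) j := rfl

/-- The subfield contains every `x i`, so all `dxᵢ` die in the relative differentials and `K` is
separable over it. It also contains all `p`-th powers, so `K` is purely inseparable over it. Hence
it is all of `K`. -/
theorem mem_homogField [Algebra.EssFiniteType k K] (x : ι → K) (e : Basis ι K (Ω[K⁄k]))
    (he : ∀ i, e i = D k K (x i)) (a : K) : a ∈ homogField p (logDer x e) := by
  classical
  set S := homogField p (logDer x e)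
  have hx : ∀ i, x i ∈ S := fun i ↦ Submodule.mem_iSup_of_mem (Pi.single i 1) fun j ↦ by
    rw [logDer_apply, ← he, Basis.repr_self, Finsupp.single_apply, Pi.single_apply]
    by_cases h : i = j
    · subst h; simp
    · simp [h, Ne.symm h]
  have h1 : Subsingleton (Ω[K⁄S]) := by
    have h2 : ∀ i, KaehlerDifferential.map k S K K (e i) = 0 := fun i ↦ by
      rw [he, map_D]
      exact (D S K).map_algebraMap ⟨x i, hx i⟩
    have h3 : KaehlerDifferential.map k S K K = 0 := e.ext h2
    refine ⟨fun a b ↦ ?_⟩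
    obtain ⟨a, rfl⟩ := KaehlerDifferential.map_surjective k S K a
    obtain ⟨b, rfl⟩ := KaehlerDifferential.map_surjective k S K b
    rw [h3, LinearMap.zero_apply, LinearMap.zero_apply]
  have : Algebra.FormallyUnramified S K := ⟨h1⟩
  have : Algebra.EssFiniteType S K := .of_comp k S K
  have : Algebra.IsSeparable S K := Algebra.FormallyUnramified.isSeparable S K
  have : CharP S p := (algebraMap S K).charP (algebraMap S K).injective p
  have : ExpChar S p := ExpChar.prime hp.out
  have : IsPurelyInseparable S K := (isPurelyInseparable_iff_pow_mem S p).mpr fun y ↦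
    ⟨1, ⟨y ^ p ^ 1, Submodule.mem_iSup_of_mem 0 (by rw [pow_one]; exact homog_pow_char y)⟩, rfl⟩
  obtain ⟨b, rfl⟩ := IsPurelyInseparable.surjective_algebraMap_of_isSeparable S K a
  exact b.2

/-- The forms `xᵢ ^ (p - 1) dxᵢ + dyᵢ` are linearly independent if `dxᵢ` form a basis. -/
theorem det_pow_smul_add_ne_zero [Fintype ι] [DecidableEq ι] [Algebra.EssFiniteType k K]
    (x : ι → K) (e : Basis ι K (Ω[K⁄k])) (he : ∀ i, e i = D k K (x i)) (y : ι → K) :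
    e.det (fun i ↦ x i ^ (p - 1) • D k K (x i) + D k K (y i)) ≠ 0 := by
  have hx : ∀ i, x i ≠ 0 := fun i h ↦ e.ne_zero i (by rw [he, h, map_zero])
  have hu : ∀ i, ∃ c : (ι → ZMod p) → K, (∀ α, c α ∈ homog (logDer x e) α) ∧
      ∑ α, c α = y i / x i ^ p := fun i ↦ by
    obtain ⟨c, hc, h⟩ := (Submodule.mem_iSup_iff_exists_finsupp _ _).mp
      ((mem_homogField_iff _).mp (mem_homogField (p := p) x e he (y i / x i ^ p)))
    exact ⟨c, hc, by rw [← h, Finsupp.sum_fintype _ _ fun _ ↦ rfl]⟩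
  choose c hc hcu using hu
  have h1 := homogProj_det c hc
  intro h0
  refine one_ne_zero (α := K) ?_
  rw [← h1, ← map_zero (homogProj p (logDer x e))]
  congr 1
  -- Scaling row `i` by `x i ^ (-p)` and column `j` by `x j` turns the coordinates `xᵢ ^ (p - 1) δᵢⱼ
  -- + ∂ⱼ yᵢ` into `δᵢⱼ + xⱼ ∂ⱼ (yᵢ / xᵢ ^ p)`, as `xᵢ ^ p` is a constant for the derivations.
  have h2 : (Matrix.of fun i j ↦ (1 : Matrix ι ι K) i j + logDer x e j (∑ α, c i α)) =
      Matrix.of fun i j ↦ (x i ^ p)⁻¹ * Matrix.of (fun i j ↦ x j * (e.toMatrix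
        fun i ↦ x i ^ (p - 1) • D k K (x i) + D k K (y i)).transpose i j) i j := by
    ext i j
    rw [Matrix.of_apply, Matrix.of_apply, Matrix.of_apply, Matrix.transpose_apply,
      Basis.toMatrix_apply, hcu, logDer_apply, div_eq_mul_inv, ← inv_pow, Derivation.leibniz,
      ← he, LiftData.d_pow_eq_zero k (CharP.cast_eq_zero K p), smul_zero, zero_add, map_add,
      map_smul, map_smul, Basis.repr_self, Finsupp.add_apply, Finsupp.smul_apply,
      Finsupp.smul_apply, Finsupp.single_apply, Matrix.one_apply, smul_eq_mul, smul_eq_mul,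
      inv_pow]
    have h3 : x i ^ p = x i ^ (p - 1) * x i := by
      rw [← pow_succ, Nat.sub_add_cancel hp.out.one_le]
    have h4 := pow_ne_zero p (hx i)
    by_cases h : i = j
    · subst h
      rw [if_pos rfl]
      have h5 := pow_ne_zero (p - 1) (hx i)
      have h6 := hx i
      rw [h3]
      field_simp
    · rw [if_neg h]
      ring
  rw [h2, Matrix.det_mul_column, Matrix.det_mul_row, Matrix.det_transpose, ← Basis.det_apply, h0,
    mul_zero, mul_zero]

end Homogeneous

/-! ### Symmetric and exterior algebra, and functoriality of differentials. -/

section General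

variable {R M N : Type*} [CommRing R] [AddCommGroup M] [Module R M] [AddCommGroup N] [Module R N]

theorem symmetricAlgebra_hom_ext {S : Type*} [CommRing S] [Algebra R S]
    {F G : SymmetricAlgebra R M →ₐ[R] S}
    (h : ∀ x, F (SymmetricAlgebra.ι R M x) = G (SymmetricAlgebra.ι R M x)) : F = G :=
  SymmetricAlgebra.algHom_ext (LinearMap.ext h)

theorem exteriorPower_hom_ext {n : ℕ} {F G : ⋀[R]^n M →ₗ[R] N}
    (h : ∀ v, F (exteriorPower.ιMulti R n v) = G (exteriorPower.ιMulti R n v)) : F = G :=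
  exteriorPower.linearMap_ext (AlternatingMap.ext h)

theorem symmetricAlgebra_exteriorPower_hom_ext {n : ℕ} {S : Type*} [CommRing S] [Algebra R S]
    {F G : SymmetricAlgebra R (⋀[R]^n M) →ₐ[R] S}
    (h : ∀ v, F (SymmetricAlgebra.ι R _ (exteriorPower.ιMulti R n v)) =
      G (SymmetricAlgebra.ι R _ (exteriorPower.ιMulti R n v))) : F = G :=
  SymmetricAlgebra.algHom_ext (exteriorPower_hom_ext h)

/-- Functoriality of the symmetric algebra. -/
def symMap (f : M →ₗ[R] N) : SymmetricAlgebra R M →ₐ[R] SymmetricAlgebra R N :=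
  SymmetricAlgebra.lift (SymmetricAlgebra.ι R N ∘ₗ f)

theorem symMap_ι (f : M →ₗ[R] N) (x : M) :
    symMap f (SymmetricAlgebra.ι R M x) = SymmetricAlgebra.ι R N (f x) :=
  SymmetricAlgebra.lift_ι_apply _ _

theorem symMap_injective {f : M →ₗ[R] N} {g : N →ₗ[R] M} (h : g ∘ₗ f = .id) :
    Function.Injective (symMap f) := by
  have h1 : (symMap g).comp (symMap f) = AlgHom.id R _ := symmetricAlgebra_hom_ext fun x ↦ by
    rw [AlgHom.comp_apply, symMap_ι, symMap_ι, show g (f x) = x from LinearMap.congr_fun h x]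
    rfl
  exact Function.LeftInverse.injective (g := symMap g) fun x ↦ DFunLike.congr_fun h1 x

theorem equivMvPolynomial_ι_eq_sum {κ : Type*} [Fintype κ] (b : Module.Basis κ R M) (x : M) :
    SymmetricAlgebra.equivMvPolynomial b (SymmetricAlgebra.ι R M x) =
      ∑ i, b.repr x i • MvPolynomial.X i := by
  conv_lhs => rw [← b.sum_repr x]
  simp only [map_sum, map_smul, SymmetricAlgebra.equivMvPolynomial_ι_apply]

theorem kaehler_induction {k A : Type*} [CommRing k] [CommRing A] [Algebra k A]
    {P : Ω[A⁄k] → Prop} (d : ∀ a, P (KaehlerDifferential.D k A a)) (zero : P 0)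
    (add : ∀ x y, P x → P y → P (x + y)) (smul : ∀ (a : A) x, P x → P (a • x)) (w : Ω[A⁄k]) :
    P w := by
  have h : w ∈ Submodule.span A (Set.range (KaehlerDifferential.D k A)) := by
    rw [KaehlerDifferential.span_range_derivation]
    exact Submodule.mem_top
  induction h using Submodule.span_induction with
  | mem x h => obtain ⟨a, rfl⟩ := h; exact d a
  | zero => exact zero
  | add x y _ _ hx hy => exact add x y hx hy
  | smul a x _ hx => exact smul a x hx

theorem kaehlerMap_kaehlerMap {k A B C : Type*} [CommRing k] [CommRing A] [CommRing B] [CommRing C]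
    [Algebra k A] [Algebra k B] [Algebra k C] [Algebra A B] [Algebra B C] [Algebra A C]
    [IsScalarTower k A B] [IsScalarTower k B C] [IsScalarTower k A C] [IsScalarTower A B C]
    (w : Ω[A⁄k]) : KaehlerDifferential.map k k B C (KaehlerDifferential.map k k A B w) =
      KaehlerDifferential.map k k A C w := by
  induction w using kaehler_induction with
  | d a => simp [IsScalarTower.algebraMap_apply A B C]
  | zero => simp
  | add x y hx hy => simp only [map_add, hx, hy]
  | smul a x hx => rw [map_smul, ← algebraMap_smul B, map_smul, hx, map_smul, algebraMap_smul]

theorem alternatingMap_eq_det_smul {n : ℕ} (f : M [⋀^Fin n]→ₗ[R] N) (b : Module.Basis (Fin n) R M)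
    (v : Fin n → M) : f v = b.det v • f b := by
  suffices h : f = (LinearMap.toSpanSingleton R N (f b)).compAlternatingMap b.det from
    DFunLike.congr_fun h v
  refine Module.Basis.ext_alternating b fun σ hσ ↦ ?_
  let τ : Equiv.Perm (Fin n) := Equiv.ofBijective σ (Finite.injective_iff_bijective.mp hσ)
  change f (b ∘ τ) = b.det (b ∘ τ) • f b
  rw [AlternatingMap.map_perm, AlternatingMap.map_perm, Module.Basis.det_self, smul_assoc, one_smul]

end General

/-! ### Generic values of pluri-forms. -/

section PluriForms

open KaehlerDifferential Module

variable {k : Type u} [CommRing k] {n : ℕ} (A : Type u) [CommRing A] [Algebra k A]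
  {K : Type u} [Field K] [Algebra k K] [Algebra A K] [IsScalarTower k A K]
  (e : Basis (Fin n) K (Ω[K⁄k]))

/-- The alternating map `(ω₁, …, ωₙ) ↦ det (ω₁|_K, …, ωₙ|_K)` with respect to a basis over `K`. -/
def detAlternating : (Ω[A⁄k]) [⋀^Fin n]→ₗ[A] K :=
  { (e.det.toMultilinearMap.restrictScalars A).compLinearMap
      (fun _ ↦ KaehlerDifferential.map k k A K) with
    map_eq_zero_of_eq' := fun v _ _ h hij ↦ e.det.map_eq_zero_of_eq
      (fun l ↦ KaehlerDifferential.map k k A K (v l)) (congrArg _ h) hij }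

/-- The value of pluri-forms in the function field, with respect to a basis of the differentials. -/
def toPoly : PluriForms k n A →ₐ[A] Polynomial K :=
  SymmetricAlgebra.lift (((Polynomial.monomial 1 : K →ₗ[K] Polynomial K).restrictScalars A) ∘ₗ
    exteriorPower.alternatingMapLinearEquiv (detAlternating A e))

variable {A}

theorem toPoly_ι (w : Forms k n A) : toPoly A e (SymmetricAlgebra.ι A _ w) =
    Polynomial.monomial 1 (exteriorPower.alternatingMapLinearEquiv (detAlternating A e) w) := by
  rw [toPoly, SymmetricAlgebra.lift_ι_apply]
  rfl

theorem toPoly_ι_ιMulti (w : Fin n → Ω[A⁄k]) :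
    toPoly A e (SymmetricAlgebra.ι A _ (exteriorPower.ιMulti A n w)) =
      Polynomial.monomial 1 (e.det fun i ↦ KaehlerDifferential.map k k A K (w i)) := by
  rw [toPoly_ι, exteriorPower.alternatingMapLinearEquiv_apply_ιMulti]
  rfl

theorem toPoly_mem {m : ℕ} {s : PluriForms k n A} (hs : s ∈ pluriFormsDeg k n A m) :
    ∃ a : K, toPoly A e s = Polynomial.monomial m a := by
  rw [pluriFormsDeg, Submodule.restrictScalars_mem] at hs
  let N : Submodule A (Polynomial K) :=
    (LinearMap.range (Polynomial.monomial m : K →ₗ[K] Polynomial K)).restrictScalars A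
  suffices h : s ∈ N.comap (toPoly A e).toLinearMap by
    obtain ⟨a, ha⟩ := h
    exact ⟨a, ha.symm⟩
  induction hs using Submodule.pow_induction_on_left' with
  | algebraMap r => exact ⟨algebraMap A K r, by simp⟩
  | add x y i _ _ hx hy => exact add_mem hx hy
  | mem_mul x hx i y _ hy =>
    obtain ⟨w, rfl⟩ := hx
    obtain ⟨a, ha⟩ := hy
    refine ⟨exteriorPower.alternatingMapLinearEquiv (detAlternating A e) w * a, ?_⟩
    change Polynomial.monomial i a = toPoly A e y at ha
    change _ = toPoly A e (_ * y)
    rw [map_mul (toPoly A e), toPoly_ι, ← ha, Polynomial.monomial_mul_monomial, add_comm]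

theorem toPoly_pluriFormsMap {B : Type u} [CommRing B] [Algebra k B] [Algebra B K]
    [IsScalarTower k B K] (φ : A →ₐ[k] B) (hφ : ∀ a, algebraMap B K (φ a) = algebraMap A K a)
    (s : PluriForms k n A) : toPoly B e (pluriFormsMap k n φ s) = toPoly A e s := by
  let _ : Algebra A B := φ.toRingHom.toAlgebra
  have : IsScalarTower k A B := .of_algebraMap_eq' φ.comp_algebraMap.symm
  have : IsScalarTower A B K := .of_algebraMap_eq fun a ↦ (hφ a).symm
  change (((toPoly B e).restrictScalars A).comp (pluriFormsMapAux k n A B)) s = _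
  congr 1
  refine SymmetricAlgebra.algHom_ext (LinearMap.ext fun w ↦ ?_)
  change toPoly B e (pluriFormsMapAux k n A B (SymmetricAlgebra.ι A _ w)) =
    toPoly A e (SymmetricAlgebra.ι A _ w)
  rw [pluriFormsMapAux, SymmetricAlgebra.lift_ι_apply, toPoly_ι]
  change toPoly B e (SymmetricAlgebra.ι B _ (formsMapAux k n A B w)) = _
  rw [toPoly_ι]
  congr 1
  change (((exteriorPower.alternatingMapLinearEquiv (detAlternating B e)).restrictScalars A) ∘ₗ
    formsMapAux k n A B) w = _
  congr 1
  refine exteriorPower.linearMap_ext (AlternatingMap.ext fun v ↦ ?_)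
  simp only [LinearMap.compAlternatingMap_apply, LinearMap.comp_apply, formsMapAux,
    exteriorPower.alternatingMapLinearEquiv_apply_ιMulti, LinearMap.coe_restrictScalars]
  change exteriorPower.alternatingMapLinearEquiv (detAlternating B e)
    (exteriorPower.ιMulti B n fun i ↦ KaehlerDifferential.map k k A B (v i)) = _
  rw [exteriorPower.alternatingMapLinearEquiv_apply_ιMulti]
  change e.det (fun i ↦ KaehlerDifferential.map k k B K (KaehlerDifferential.map k k A B (v i))) =
    e.det (fun i ↦ KaehlerDifferential.map k k A K (v i))
  congr 1
  funext i
  exact kaehlerMap_kaehlerMap _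

/-- Being finite projective, `Ω[A⁄k]` is a direct summand of some `A ^ r`. Hence the pluri-forms
embed into the symmetric algebra of `⋀ⁿ A ^ r`, a polynomial ring over `A`, and so into one over
`K`. This embedding factors through `toPoly`: follow it by sending the variable to the image `y` of
the generator `e₁ ∧ ⋯ ∧ eₙ`. -/
theorem toPoly_injective [IsDomain A] [IsFractionRing A K] [Module.Finite A (Ω[A⁄k])]
    [Module.Projective A (Ω[A⁄k])] : Function.Injective (toPoly A e) := by
  obtain ⟨r, q, i, -, -, hqi⟩ := Module.Finite.exists_comp_eq_id_of_projective A (Ω[A⁄k])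
  have : Algebra.FormallyEtale A K := .of_isLocalization (nonZeroDivisors A)
  let j : Ω[K⁄k] →ₗ[K] (Fin r → K) :=
    (isBaseChange_of_formallyEtale k A K).lift ((Algebra.linearMap A K).compLeft (Fin r) ∘ₗ i)
  have hj : ∀ w, j (KaehlerDifferential.map k k A K w) = fun l ↦ algebraMap A K (i w l) :=
    fun w ↦ IsBaseChange.lift_eq _ _ _
  let bA := (Pi.basisFun A (Fin r)).exteriorPower n
  let F : ∀ s : Set.powersetCard (Fin r) n, (Ω[K⁄k]) [⋀^Fin n]→ₗ[K] K := fun s ↦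
    (exteriorPower.ιMultiDual K n (Pi.basisFun K (Fin r)) s ∘ₗ
      exteriorPower.map n j).compAlternatingMap (exteriorPower.ιMulti K n)
  have hF : ∀ s w, F s (fun l ↦ KaehlerDifferential.map k k A K (w l)) =
      algebraMap A K (bA.repr (exteriorPower.ιMulti A n (i ∘ w)) s) := fun s w ↦ by
    rw [exteriorPower.basis_repr_apply, exteriorPower.ιMultiDual_apply_ιMulti, RingHom.map_det]
    simp only [F, LinearMap.compAlternatingMap_apply, LinearMap.comp_apply,
      exteriorPower.map_apply_ιMulti, exteriorPower.ιMultiDual_apply_ιMulti]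
    congr 1
    ext a b
    simp [hj]
  let G : PluriForms k n A →ₐ[A] SymmetricAlgebra A (⋀[A]^n (Fin r → A)) :=
    symMap (exteriorPower.map n i)
  have hGi : Function.Injective G := symMap_injective (g := exteriorPower.map n q) (by
    rw [← exteriorPower.map_comp, hqi, exteriorPower.map_id])
  let H : MvPolynomial (Set.powersetCard (Fin r) n) A →ₐ[A]
      MvPolynomial (Set.powersetCard (Fin r) n) K := MvPolynomial.mapAlgHom (Algebra.ofId A K)
  have hH : Function.Injective H :=
    MvPolynomial.map_injective _ (IsFractionRing.injective A K)
  let y : MvPolynomial (Set.powersetCard (Fin r) n) K := ∑ s, F s e • MvPolynomial.X s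
  have hcomp : ((Polynomial.aeval (R := K) y).restrictScalars A).comp (toPoly A e) =
      (H.comp (SymmetricAlgebra.equivMvPolynomial bA).toAlgHom).comp G := by
    refine symmetricAlgebra_exteriorPower_hom_ext fun w ↦ ?_
    change Polynomial.aeval (R := K) y (toPoly A e (SymmetricAlgebra.ι A _
      (exteriorPower.ιMulti A n w))) = H (SymmetricAlgebra.equivMvPolynomial bA
        (symMap (exteriorPower.map n i) (SymmetricAlgebra.ι A _ (exteriorPower.ιMulti A n w))))
    rw [symMap_ι, exteriorPower.map_apply_ιMulti, toPoly_ι_ιMulti]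
    rw [equivMvPolynomial_ι_eq_sum, map_sum, Polynomial.aeval_monomial, pow_one,
      ← Algebra.smul_def, Finset.smul_sum]
    refine Finset.sum_congr rfl fun s _ ↦ ?_
    rw [map_smul, smul_smul]
    have h1 : H (MvPolynomial.X s) = MvPolynomial.X s := MvPolynomial.map_X _ _
    rw [h1, ← algebraMap_smul K (bA.repr (exteriorPower.ιMulti A n (i ∘ w)) s), ← hF,
      alternatingMap_eq_det_smul (F s) e fun l ↦ KaehlerDifferential.map k k A K (w l)]
    simp
  have h2 : Function.Injective (((Polynomial.aeval (R := K) y).restrictScalars A).comp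
      (toPoly A e)) := by
    rw [hcomp]
    exact (hH.comp (SymmetricAlgebra.equivMvPolynomial bA).injective).comp hGi
  exact Function.Injective.of_comp (f := (Polynomial.aeval (R := K) y).restrictScalars A) h2

theorem toPoly_mem_of_basis (b : Basis (Fin n) A (Ω[A⁄k])) {m : ℕ} {s : PluriForms k n A}
    (hs : s ∈ pluriFormsDeg k n A m) : ∃ a : A, toPoly A e s = Polynomial.monomial m
      (algebraMap A K a * e.det (fun i ↦ KaehlerDifferential.map k k A K (b i)) ^ m) := by
  set u := e.det (fun i ↦ KaehlerDifferential.map k k A K (b i)) with hu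
  have hw : ∀ w : Forms k n A, exteriorPower.alternatingMapLinearEquiv (detAlternating A e) w =
      algebraMap A K (exteriorPower.alternatingMapLinearEquiv b.det w) * u := fun w ↦ by
    have : exteriorPower.alternatingMapLinearEquiv (detAlternating A e) =
        LinearMap.toSpanSingleton A K u ∘ₗ exteriorPower.alternatingMapLinearEquiv b.det := by
      refine exteriorPower_hom_ext fun v ↦ ?_
      rw [LinearMap.comp_apply, exteriorPower.alternatingMapLinearEquiv_apply_ιMulti,
        exteriorPower.alternatingMapLinearEquiv_apply_ιMulti, alternatingMap_eq_det_smul _ b]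
      rfl
    rw [this, LinearMap.comp_apply, LinearMap.toSpanSingleton_apply, Algebra.smul_def]
  rw [pluriFormsDeg, Submodule.restrictScalars_mem] at hs
  suffices h : s ∈ (Submodule.span A {(Polynomial.monomial m (u ^ m) : Polynomial K)}).comap
      (toPoly A e).toLinearMap by
    obtain ⟨a, ha⟩ := Submodule.mem_span_singleton.mp h
    refine ⟨a, ha.symm.trans ?_⟩
    rw [Polynomial.smul_monomial, Algebra.smul_def]
  induction hs using Submodule.pow_induction_on_left' with
  | algebraMap r =>
    exact Submodule.mem_span_singleton.mpr ⟨r, by simp [Algebra.smul_def]⟩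
  | add x y i _ _ hx hy => exact add_mem hx hy
  | mem_mul x hx i y _ hy =>
    obtain ⟨w, rfl⟩ := hx
    obtain ⟨a, ha⟩ := Submodule.mem_span_singleton.mp hy
    refine Submodule.mem_span_singleton.mpr
      ⟨exteriorPower.alternatingMapLinearEquiv b.det w * a, ?_⟩
    change _ = toPoly A e y at ha
    change _ = toPoly A e (_ * y)
    rw [map_mul (toPoly A e), toPoly_ι, ← ha, Polynomial.smul_monomial, Polynomial.smul_monomial,
      Polynomial.monomial_mul_monomial, hw, Algebra.smul_def, Algebra.smul_def,
      map_mul (algebraMap A K), Nat.succ_eq_add_one, add_comm 1 i]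
    congr 1
    ring

end PluriForms

/-! ### Semilinear extension of Frobenius derivations and its determinant. -/

section Semilinear

open KaehlerDifferential Module

namespace IsFrobDer

variable {p : ℕ} [hp : Fact p.Prime] {A M : Type*} [CommRing A] [AddCommGroup M] [Module A M]
  {D : A → M}

omit hp in
theorem map_one (h : IsFrobDer p D) : D 1 = 0 := by simpa using h.map_mul 1 1

omit hp in
theorem map_pow (h : IsFrobDer p D) (a : A) (n : ℕ) : D (a ^ n) = n • (a ^ p) ^ (n - 1) • D a := by
  induction n with
  | zero => simp [h.map_one]
  | succ n ih =>
    rw [pow_succ, h.map_mul, ih, Nat.add_sub_cancel, add_smul, one_smul, ← pow_mul, ← pow_mul,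
      ← pow_mul, mul_comm n p, add_comm, smul_comm, smul_smul]
    rcases n with _ | n
    · simp
    · rw [Nat.add_sub_cancel, ← pow_add, mul_add, mul_one, add_comm p]

omit hp in
theorem map_algebraMap (h : IsFrobDer p D) (hpA : (p : A) = 0) {k : Type*} [CommRing k]
    [Algebra k A] (hk : ∀ c : k, ∃ d, c = d ^ p) (c : k) : D (algebraMap k A c) = 0 := by
  obtain ⟨d, rfl⟩ := hk c
  rw [_root_.map_pow, h.map_pow, ← Nat.cast_smul_eq_nsmul A, hpA, zero_smul]

omit hp in
/-- Frobenius derivations extend uniquely to quotients. -/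
theorem eq_of_mul_eq {K N : Type*} [Field K] [CharP K p] [AddCommGroup N] [Module K N] {ι : A →+* K}
    (hι : Function.Injective ι) {D D' : A → N}
    (hD : ∀ a b, D (a * b) = ι a ^ p • D b + ι b ^ p • D a)
    (hD' : ∀ a b, D' (a * b) = ι a ^ p • D' b + ι b ^ p • D' a) {a s : A} (hs : s ≠ 0)
    (h1 : D s = D' s) (h2 : D (a * s) = D' (a * s)) : D a = D' a := by
  rw [hD, hD', h1] at h2
  have h3 : ι s ^ p ≠ 0 := pow_ne_zero _ ((map_ne_zero_iff ι hι).mpr hs)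
  exact smul_right_injective N h3 (add_left_cancel h2)

end IsFrobDer

/-- Restriction of scalars of a vector space along the Frobenius. -/
def FrobTwist (_ : ℕ) (K M : Type*) [Field K] [AddCommGroup M] [Module K M] : Type _ := M

section

variable (p : ℕ) [hp : Fact p.Prime] (K M : Type*) [Field K] [CharP K p] [AddCommGroup M]
  [Module K M]

instance : AddCommGroup (FrobTwist p K M) := inferInstanceAs (AddCommGroup M)

instance : Module K (FrobTwist p K M) := Module.compHom M (frobenius K p)

end

variable {p : ℕ} [hp : Fact p.Prime] {k A K : Type u} [CommRing k] [CommRing A] [Field K]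
  [Algebra k A] [Algebra k K] [Algebra A K] [IsScalarTower k A K] [CharP K p]

/-- With the target twisted by Frobenius, `D₀` becomes an ordinary derivation. It is `k`-linear
because elements of `k` are `p`-th powers, on which it vanishes. The universal property and
localization of differentials then extend it to `K`. -/
theorem exists_semilinear [IsDomain A] [IsFractionRing A K] (hk : ∀ c : k, ∃ d, c = d ^ p)
    (D₀ : A → Ω[A⁄k]) (hD : IsFrobDer p D₀) :
    ∃ ξ : Ω[K⁄k] →+ Ω[K⁄k], (∀ (c : K) w, ξ (c • w) = c ^ p • ξ w) ∧
      ∀ a, ξ (D k K (algebraMap A K a)) = KaehlerDifferential.map k k A K (D₀ a) := by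
  have hpA : (p : A) = 0 := IsFractionRing.injective A K (by simp)
  let T := FrobTwist p K (Ω[K⁄k])
  let _ : Module A T := Module.compHom T (algebraMap A K)
  let _ : Module k T := Module.compHom T (algebraMap k K)
  have hA : ∀ (a : A) (t : Ω[K⁄k]), (show Ω[K⁄k] from (a • (show T from t))) =
    (algebraMap A K a) ^ p • t := fun _ _ ↦ rfl
  have hK : ∀ (a : k) (t : Ω[K⁄k]), (show Ω[K⁄k] from (a • (show T from t))) =
    (algebraMap k K a) ^ p • t := fun _ _ ↦ rfl
  have : IsScalarTower A K T := ⟨fun a c t ↦ by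
    rw [Algebra.smul_def, mul_smul]; rfl⟩
  have : IsScalarTower k A T := ⟨fun a (c : A) (t : T) ↦ by
    rw [Algebra.smul_def, mul_smul]
    exact congrArg (fun r : K ↦ r • (algebraMap A K c • t))
      (IsScalarTower.algebraMap_apply k A K a).symm⟩
  let f : A → Ω[K⁄k] := fun a ↦ KaehlerDifferential.map k k A K (D₀ a)
  have hf : ∀ a b, f (a * b) = algebraMap A K a ^ p • f b + algebraMap A K b ^ p • f a :=
    fun a b ↦ by
      simp only [f, hD.map_mul, map_add, map_smul, ← map_pow, algebraMap_smul]
  let d : Derivation k A T := Derivation.mk'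
    { toFun := fun a ↦ (show T from f a)
      map_add' := fun a b ↦ (congrArg _ (hD.map_add a b)).trans (map_add _ _ _)
      map_smul' := fun c a ↦ by
        change f (c • a) = algebraMap k K c ^ p • f a
        rw [Algebra.smul_def, hf, ← IsScalarTower.algebraMap_apply]
        have : f (algebraMap k A c) = 0 := by
          simp only [f, hD.map_algebraMap hpA hk, map_zero]
        rw [this, smul_zero, add_zero] }
    fun a b ↦ hf a b
  have : Algebra.FormallyEtale A K := .of_isLocalization (nonZeroDivisors A)
  let g : Ω[K⁄k] →ₗ[K] T := (isBaseChange_of_formallyEtale k A K).lift d.liftKaehlerDifferential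
  refine ⟨g.toAddMonoidHom, fun c w ↦ g.map_smul c w, fun a ↦ ?_⟩
  have : g (KaehlerDifferential.map k k A K (D k A a)) = d.liftKaehlerDifferential (D k A a) :=
    IsBaseChange.lift_eq _ _ _
  rw [map_D, Derivation.liftKaehlerDifferential_comp_D] at this
  exact this

theorem det_sum_smul {R M : Type*} [CommRing R] [AddCommGroup M] [Module R M] {n : ℕ}
    (e : Basis (Fin n) R M) (N : Matrix (Fin n) (Fin n) R) (w : Fin n → M) :
    e.det (fun i ↦ ∑ j, N i j • w j) = N.det * e.det w := by
  rw [Basis.det_apply, Basis.det_apply, ← Matrix.det_transpose N, mul_comm, ← Matrix.det_mul]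
  congr 1
  ext i j
  simp [Basis.toMatrix_apply, Matrix.mul_apply, mul_comm]

/-- The pairing of an `m`-canonical form with the determinant of `dF / p` is regular wherever the
differentials are free. -/
theorem exists_eq_pow_mul_pow {n : ℕ} (e : Basis (Fin n) K (Ω[K⁄k])) (ξ : Ω[K⁄k] →+ Ω[K⁄k])
    (hξ : ∀ (c : K) w, ξ (c • w) = c ^ p • ξ w)
    (hξA : ∀ a, ∃ w, ξ (D k K (algebraMap A K a)) = KaehlerDifferential.map k k A K w)
    (b : Basis (Fin n) A (Ω[A⁄k])) {m : ℕ} {s : PluriForms k n A} (hs : s ∈ pluriFormsDeg k n A m)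
    {a : K} (ha : toPoly A e s = Polynomial.monomial m a) :
    ∃ c : A, algebraMap A K c = a ^ (p - 1) * e.det (ξ ∘ e) ^ m := by
  have hA : ∀ w, ∃ w', ξ (KaehlerDifferential.map k k A K w) =
      KaehlerDifferential.map k k A K w' := fun w ↦ by
    induction w using kaehler_induction with
    | d a =>
      obtain ⟨w, hw⟩ := hξA a
      exact ⟨w, by rw [map_D, hw]⟩
    | zero => exact ⟨0, by simp⟩
    | add x y hx hy =>
      obtain ⟨x', hx⟩ := hx
      obtain ⟨y', hy⟩ := hy
      exact ⟨x' + y', by rw [map_add, map_add, map_add, hx, hy]⟩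
    | smul a x hx =>
      obtain ⟨x', hx⟩ := hx
      refine ⟨a ^ p • x', ?_⟩
      rw [map_smul, ← algebraMap_smul K, hξ, hx, map_smul, ← algebraMap_smul K (a ^ p), map_pow]
  choose η hη using hA
  set u := e.det (fun i ↦ KaehlerDifferential.map k k A K (b i)) with hu
  set h := e.det (ξ ∘ e) with hh
  let N : Matrix (Fin n) (Fin n) A := fun i j ↦ b.repr (η (b i)) j
  let Q : Matrix (Fin n) (Fin n) K := fun i j ↦ e.repr (KaehlerDifferential.map k k A K (b i)) j
  have hQu : Q.det = u := by
    rw [hu, Basis.det_apply, ← Matrix.det_transpose]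
    rfl
  -- The determinant of the vectors `ξ (b i)` is computed twice: over `A` through the matrix `N` of
  -- `ξ` in the basis `b`, and over `K` through semilinearity, which raises the change of basis to
  -- the `p`-th power. Comparison gives `det N = u ^ (p - 1) * h`, so that `a = c * u ^ m` yields `a
  -- ^ (p - 1) * h ^ m = c ^ (p - 1) * det N ^ m`.
  have h1 : e.det (fun i ↦ ξ (KaehlerDifferential.map k k A K (b i))) =
      algebraMap A K N.det * u := by
    rw [RingHom.map_det, hu, ← det_sum_smul]
    congr 1
    funext i
    rw [hη]
    conv_lhs => rw [← b.sum_repr (η (b i)), map_sum]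
    refine Finset.sum_congr rfl fun j _ ↦ ?_
    rw [map_smul, ← algebraMap_smul K]
    rfl
  have h2 : e.det (fun i ↦ ξ (KaehlerDifferential.map k k A K (b i))) = u ^ p * h := by
    have h3 : u ^ p = (Q.map (frobenius K p)).det := by
      rw [← hQu, ← frobenius_def, RingHom.map_det]
      rfl
    rw [h3, hh, ← det_sum_smul]
    congr 1
    funext i
    conv_lhs => rw [← e.sum_repr (KaehlerDifferential.map k k A K (b i)), map_sum]
    refine Finset.sum_congr rfl fun j _ ↦ ?_
    rw [hξ]
    rfl
  obtain ⟨c, hc⟩ := toPoly_mem_of_basis e b hs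
  rw [ha] at hc
  have hc' : a = algebraMap A K c * u ^ m := Polynomial.monomial_injective m hc
  rw [hc']
  by_cases hu0 : u ^ m = 0
  · exact ⟨0, by rw [hu0, mul_zero, zero_pow (Nat.sub_ne_zero_of_lt hp.out.one_lt), zero_mul,
      map_zero]⟩
  refine ⟨c ^ (p - 1) * N.det ^ m, ?_⟩
  rw [map_mul, map_pow, map_pow]
  rcases Nat.eq_zero_or_pos m with rfl | hm
  · simp
  have h4 : algebraMap A K N.det = u ^ (p - 1) * h := by
    refine mul_right_cancel₀ (pow_ne_zero_iff hm.ne' |>.mp hu0) ?_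
    rw [← h1, h2]
    have : u ^ p = u ^ (p - 1) * u := by rw [← pow_succ, Nat.sub_add_cancel hp.out.one_le]
    rw [this]
    ring
  rw [h4]
  ring

end Semilinear

/-! ### From flat liftings of schemes to lifting data for rings. -/

/-- The quotient of `B` by the ideal generated by `ker r` receives compatible maps from `B` and `k`,
so the projection from `B` factors through the pushout `A`. -/
theorem mem_map_ker_of_isPushout {W B k A : CommRingCat.{u}} {φ : W ⟶ B} {r : W ⟶ k} {π : B ⟶ A}
    {ψ : k ⟶ A} (h : IsPushout φ r π ψ) (hr : Function.Surjective r.hom) {b : B}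
    (hb : π.hom b = 0) : b ∈ (RingHom.ker r.hom).map φ.hom := by
  let I := (RingHom.ker r.hom).map φ.hom
  have hI : RingHom.ker r.hom ≤ RingHom.ker ((Ideal.Quotient.mk I).comp φ.hom) := fun w hw ↦ by
    rw [RingHom.mem_ker, RingHom.comp_apply, Ideal.Quotient.eq_zero_iff_mem]
    exact Ideal.mem_map_of_mem _ hw
  let θ : k →+* B ⧸ I := (r.hom.liftOfRightInverse (Function.surjInv hr)
    (Function.rightInverse_surjInv hr)) ⟨_, hI⟩
  have hθ : ∀ w, θ (r.hom w) = Ideal.Quotient.mk I (φ.hom w) := fun w ↦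
    r.hom.liftOfRightInverse_comp_apply _ (Function.rightInverse_surjInv hr) ⟨_, hI⟩ w
  have hw : φ ≫ CommRingCat.ofHom (Ideal.Quotient.mk I) = r ≫ CommRingCat.ofHom θ := by
    ext w
    exact (hθ w).symm
  have h1 := congrArg (fun F ↦ F.hom b) (h.inl_desc _ _ hw)
  change (h.desc _ _ hw).hom (π.hom b) = Ideal.Quotient.mk I b at h1
  rw [hb, map_zero] at h1
  exact Ideal.Quotient.eq_zero_iff_mem.mp h1.symm

/-- By the equational criterion for flatness the relation `q • b = 0` is trivial: `b` is a
combination with coefficients killed by `q`, hence divisible by `q`. -/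
theorem exists_eq_smul_of_flat {W B : Type*} [CommRing W] [AddCommGroup B] [Module W B]
    [Module.Flat W B] {q : W} (hq : ∀ x, q * x = 0 → ∃ y, x = q * y) {b : B} (hb : q • b = 0) :
    ∃ c : B, b = q • c := by
  have h : ∑ i : Fin 1, (fun _ ↦ q) i • (fun _ ↦ b) i = 0 := by simpa using hb
  obtain ⟨κ, a, y, h1, h2⟩ := Module.Flat.isTrivialRelation_of_sum_smul_eq_zero h
  have h3 : ∀ j, ∃ z, a 0 j = q * z := fun j ↦ hq _ (by simpa using h2 j)
  choose z hz using h3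
  refine ⟨∑ j, z j • y j, ?_⟩
  rw [show b = _ from h1 0, Finset.smul_sum]
  exact Finset.sum_congr rfl fun j _ ↦ by rw [hz, mul_smul]

theorem exists_eq_natCast_mul_of_flat {W B : Type*} [CommRing W] [CommRing B] {φ : W →+* B}
    (hφ : φ.Flat) {p : ℕ} (hp : ∀ x : W, p * x = 0 → ∃ y, x = p * y) {b : B} (hb : p * b = 0) :
    ∃ c, b = p * c := by
  let _ : Algebra W B := φ.toAlgebra
  have : Module.Flat W B := hφ
  have h : ∀ c : B, (p : W) • c = p * c := fun c ↦ by rw [Nat.cast_smul_eq_nsmul, nsmul_eq_mul]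
  obtain ⟨c, hc⟩ := exists_eq_smul_of_flat hp ((h b).trans hb)
  exact ⟨c, hc.trans (h c)⟩

section Geometry

theorem le_preimage_univ {X Y : Scheme.{u}} (f : X ⟶ Y) (U : X.Opens) : U ≤ f ⁻¹ᵁ ⊤ :=
  fun _ _ ↦ trivial

theorem appLE_congr {X Y : Scheme.{u}} {f g : X ⟶ Y} (h : f = g) (U : Y.Opens) (V : X.Opens)
    (e : V ≤ f ⁻¹ᵁ U) : f.appLE U V e = g.appLE U V (h ▸ e) := by
  subst h
  rfl

variable {p : ℕ} [hp : Fact p.Prime] {k : Type u} [Field k] [CharP k p]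

omit [CharP k p] in
theorem wittResidue_surjective : Function.Surjective (wittResidue p k) := fun c ↦
  ⟨TruncatedWittVector.mk p fun _ ↦ c, TruncatedWittVector.coeff_mk (p := p) (n := 2) (fun _ ↦ c) 0⟩

variable {X Y : Scheme.{u}} {f : X ⟶ Spec (CommRingCat.of k)}
  {g : Y ⟶ Spec (CommRingCat.of (TruncatedWittVector p 2 k))} {i : X ⟶ Y} {FY : Y ⟶ Y}

omit [CharP k p] in
theorem isClosedImmersion_of_isPullback
    (hpb : IsPullback i f g (Spec.map (CommRingCat.ofHom (wittResidue p k)))) :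
    IsClosedImmersion i := by
  have : IsClosedImmersion (Spec.map (CommRingCat.ofHom (wittResidue p k))) :=
    IsClosedImmersion.spec_of_surjective _ wittResidue_surjective
  exact MorphismProperty.of_isPullback hpb.flip this

/-- The kernel of `W₂(k) → k` is generated by `p`, which squares to zero. -/
theorem surjective_of_isPullback [PerfectRing k p]
    (hpb : IsPullback i f g (Spec.map (CommRingCat.ofHom (wittResidue p k)))) :
    Function.Surjective i := by
  have : Surjective (Spec.map (CommRingCat.ofHom (wittResidue p k))) := by
    refine ⟨fun P ↦ ?_⟩
    have h := range_comap_of_surjective _ (wittResidue p k) wittResidue_surjective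
    have hP : P ∈ PrimeSpectrum.zeroLocus (RingHom.ker (wittResidue p k) : Set _) := by
      intro x hx
      obtain ⟨y, rfl⟩ := (wittResidue_eq_zero_iff p k x).mp hx
      refine P.2.mem_of_pow_mem 2 ?_
      have : ((p : TruncatedWittVector p 2 k) * y) ^ 2 = 0 := by
        linear_combination y ^ 2 * natCast_mul_natCast_eq_zero p k
      rw [this]
      exact zero_mem _
    rw [← h] at hP
    exact hP
  have h : Surjective i := MorphismProperty.of_isPullback hpb.flip this
  exact h.1

/-- As `i` is surjective and `F_X` fixes every point, `FY` fixes every point. It therefore induces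
an endomorphism of the sections over each open. -/
theorem le_preimage_of_comp_eq [PerfectRing k p]
    (hpb : IsPullback i f g (Spec.map (CommRingCat.ofHom (wittResidue p k))))
    (hF : i ≫ FY = absFrobenius p f ≫ i) (V : Y.Opens) : V ≤ FY ⁻¹ᵁ V := by
  intro y hy
  obtain ⟨x, rfl⟩ := surjective_of_isPullback hpb y
  change FY (i x) ∈ V
  rw [← Scheme.Hom.comp_apply, hF, Scheme.Hom.comp_apply]
  exact hy

omit [CharP k p] in
/-- The square of rings underlying the restriction of a lifting to an affine open subscheme. -/
theorem isPushout_appLE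
    (hpb : IsPullback i f g (Spec.map (CommRingCat.ofHom (wittResidue p k)))) (V : Y.Opens)
    (hV : IsAffineOpen V) :
    IsPushout (g.appLE ⊤ V (le_preimage_univ _ _))
      ((Spec.map (CommRingCat.ofHom (wittResidue p k))).appLE ⊤ ⊤ (le_preimage_univ _ _))
      (i.appLE V (i ⁻¹ᵁ V) le_rfl) (f.appLE ⊤ (i ⁻¹ᵁ V) (le_preimage_univ _ _)) :=
  (isIso_pushoutSection_iff hpb (UT := ⊤) (US := ⊤) (UX := V) (UY := i ⁻¹ᵁ V) (le_preimage_univ _ _)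
    (le_preimage_univ _ _) (by simp)).mp
      (isIso_pushoutSection_of_isAffineOpen hpb _ _ _ (isAffineOpen_top _)
      (isAffineOpen_top _) hV)

omit [CharP k p] in
theorem ΓSpecIso_wittResidue (w : Γ(Spec (CommRingCat.of (TruncatedWittVector p 2 k)), ⊤)) :
    (Scheme.ΓSpecIso (CommRingCat.of k)).hom.hom
      (((Spec.map (CommRingCat.ofHom (wittResidue p k))).appLE ⊤ ⊤ (le_preimage_univ _ _)).hom w) =
    wittResidue p k ((Scheme.ΓSpecIso (CommRingCat.of (TruncatedWittVector p 2 k))).hom.hom w) := by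
  have : (Spec.map (CommRingCat.ofHom (wittResidue p k))).appLE ⊤ ⊤ (le_preimage_univ _ _) =
    (Spec.map (CommRingCat.ofHom (wittResidue p k))).appTop := Scheme.Hom.appLE_eq_app _
  rw [this]
  exact congrArg (fun F ↦ F.hom w)
    (Scheme.ΓSpecIso_naturality (CommRingCat.ofHom (wittResidue p k)))

theorem ΓSpecIso_injective (R : CommRingCat.{u}) :
    Function.Injective (Scheme.ΓSpecIso R).hom.hom :=
  (Scheme.ΓSpecIso R).commRingCatIsoToRingEquiv.injective

theorem ΓSpecIso_surjective (R : CommRingCat.{u}) :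
    Function.Surjective (Scheme.ΓSpecIso R).hom.hom :=
  (Scheme.ΓSpecIso R).commRingCatIsoToRingEquiv.surjective

theorem exists_eq_natCast_mul_of_wittResidue [PerfectRing k p]
    {w : Γ(Spec (CommRingCat.of (TruncatedWittVector p 2 k)), ⊤)} (hw : wittResidue p k
      ((Scheme.ΓSpecIso (CommRingCat.of (TruncatedWittVector p 2 k))).hom.hom w) = 0) :
    ∃ y, w = p * y := by
  obtain ⟨y, hy⟩ := (wittResidue_eq_zero_iff p k _).mp hw
  obtain ⟨y, rfl⟩ := ΓSpecIso_surjective (CommRingCat.of (TruncatedWittVector p 2 k)) y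
  refine ⟨y, ΓSpecIso_injective _ ?_⟩
  rw [map_mul, map_natCast]
  exact hy

/-- Pullback of functions along `i`. -/
def secMap (f : X ⟶ Spec (CommRingCat.of k)) (i : X ⟶ Y) (V : Y.Opens) :
    Γ(Y, V) →+* Sec f (i ⁻¹ᵁ V) := (i.app V).hom

omit hp in
theorem natCast_sec_eq_zero (f : X ⟶ Spec (CommRingCat.of k)) (U : X.Opens) :
    (p : Sec f U) = 0 := natCast_eq_zero p f U

omit hp in
theorem secMap_natCast_mul (f : X ⟶ Spec (CommRingCat.of k)) (i : X ⟶ Y) (V : Y.Opens)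
    (c : Γ(Y, V)) : secMap f i V (p * c) = 0 := by
  rw [map_mul, map_natCast, natCast_sec_eq_zero, zero_mul]

/-- The lifting data attached to an affine open subscheme. -/
def liftData [PerfectRing k p] [Flat g]
    (hpb : IsPullback i f g (Spec.map (CommRingCat.ofHom (wittResidue p k))))
    (hF : i ≫ FY = absFrobenius p f ≫ i) (V : Y.Opens) (hV : IsAffineOpen V) :
    LiftData p Γ(Y, V) (Sec f (i ⁻¹ᵁ V)) where
  proj := secMap f i V
  frob := (FY.appLE V V (le_preimage_of_comp_eq hpb hF V)).hom
  proj_surjective := by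
    have := isClosedImmersion_of_isPullback hpb
    exact i.app_surjective V hV
  proj_eq_zero_iff b := by
    constructor
    · intro hb
      have h1 := mem_map_ker_of_isPushout (isPushout_appLE hpb V hV) (b := b) (fun c ↦ by
        obtain ⟨w, hw⟩ := wittResidue_surjective (p := p)
          ((Scheme.ΓSpecIso (CommRingCat.of k)).hom.hom c)
        obtain ⟨w, rfl⟩ := ΓSpecIso_surjective (CommRingCat.of (TruncatedWittVector p 2 k)) w
        exact ⟨w, ΓSpecIso_injective _ ((ΓSpecIso_wittResidue w).trans hw)⟩)
        (by rw [Scheme.Hom.appLE_eq_app]; exact hb)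
      have h2 : (RingHom.ker ((Spec.map (CommRingCat.ofHom (wittResidue p k))).appLE ⊤ ⊤
          (le_preimage_univ _ _)).hom).map (g.appLE ⊤ V (le_preimage_univ _ _)).hom ≤
          Ideal.span {(p : Γ(Y, V))} := by
        rw [Ideal.map_le_iff_le_comap]
        intro w hw
        rw [RingHom.mem_ker] at hw
        obtain ⟨y, rfl⟩ := exists_eq_natCast_mul_of_wittResidue (p := p) (k := k) (w := w)
          (by rw [← ΓSpecIso_wittResidue, hw, map_zero])
        rw [Ideal.mem_comap, map_mul, map_natCast]
        exact Ideal.mul_mem_right _ _ (Ideal.mem_span_singleton_self _)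
      exact Ideal.mem_span_singleton.mp (h2 h1)
    · rintro ⟨c, rfl⟩
      exact secMap_natCast_mul f i V c
  proj_eq_zero_of_mul b hb := by
    obtain ⟨c, rfl⟩ := exists_eq_natCast_mul_of_flat
      (φ := (g.appLE ⊤ V (le_preimage_univ _ _)).hom) (p := p)
      (Flat.flat_appLE g (isAffineOpen_top _) hV _) (fun w hw ↦ by
        refine exists_eq_natCast_mul_of_wittResidue (p := p) (k := k) ?_
        refine wittResidue_eq_zero_of_natCast_mul_eq_zero p k _ ?_
        have := congrArg (Scheme.ΓSpecIso (CommRingCat.of (TruncatedWittVector p 2 k))).hom.hom hw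
        rw [map_mul, map_natCast, map_zero] at this
        exact this) hb
    exact secMap_natCast_mul f i V c
  mul_self := by
    have h1 : (p : Γ(Spec (CommRingCat.of (TruncatedWittVector p 2 k)), ⊤)) * p = 0 := by
      refine ΓSpecIso_injective _ ?_
      rw [map_mul, map_natCast, map_zero]
      exact natCast_mul_natCast_eq_zero p k
    have h2 := congrArg (g.appLE ⊤ V (le_preimage_univ _ _)).hom h1
    rwa [map_mul, map_natCast, map_zero] at h2
  proj_frob b := by
    have h1 : FY.appLE V V (le_preimage_of_comp_eq hpb hF V) ≫ i.app V =
        i.app V ≫ (absFrobenius p f).app (i ⁻¹ᵁ V) := by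
      have h2 := Scheme.Hom.appLE_eq_app (f := i) (U := V)
      have h3 : (absFrobenius p f).appLE (i ⁻¹ᵁ V) (i ⁻¹ᵁ V) le_rfl =
        (absFrobenius p f).app (i ⁻¹ᵁ V) := Scheme.Hom.appLE_eq_app _
      refine Eq.trans ?_ (congrArg (fun F ↦ i.app V ≫ F) h3)
      rw [← h2]
      exact ((i.appLE_comp_appLE FY V V (i ⁻¹ᵁ V) _ le_rfl).trans (appLE_congr hF V _ _)).trans
        ((absFrobenius p f).appLE_comp_appLE i V (i ⁻¹ᵁ V) (i ⁻¹ᵁ V) le_rfl le_rfl).symm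
    exact congrArg (fun F ↦ F.hom b) h1

end Geometry

/-! ### Local freeness of the differentials. -/

section Free

attribute [local instance] RingHomInvPair.of_ringEquiv in
theorem free_of_isLocalizedModule {R M : Type*} [CommRing R] [AddCommGroup M] [Module R M]
    (S : Submonoid R) (Rₛ Mₛ : Type*) [CommRing Rₛ] [Algebra R Rₛ] [IsLocalization S Rₛ]
    [AddCommGroup Mₛ] [Module R Mₛ] (f : M →ₗ[R] Mₛ) [IsLocalizedModule S f] [Module Rₛ Mₛ]
    [IsScalarTower R Rₛ Mₛ] (h : Module.Free (Localization S) (LocalizedModule S M)) :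
    Module.Free Rₛ Mₛ := by
  set e := (IsLocalization.algEquiv S (Localization S) Rₛ).toRingEquiv
  refine (Module.Free.iff_of_equiv (σ := e)
    { __ := IsLocalizedModule.iso S f, map_smul' := ?_ }).mp h
  intro r x
  obtain ⟨r, s, rfl⟩ := IsLocalization.exists_mk'_eq S r
  apply ((Module.End.isUnit_iff _).mp (IsLocalizedModule.map_units f s)).1
  simp [e, ← map_smul, ← smul_assoc]

/-- A finitely presented projective module is free at `P`, and freeness spreads out to a basic open
neighbourhood. Allowing any model `A'` of the localization lets it be applied to sections over a
basic open. -/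
theorem exists_free_kaehler {k A : Type u} [CommRing k] [CommRing A] [Algebra k A]
    [Module.FinitePresentation A (Ω[A⁄k])] [Module.Projective A (Ω[A⁄k])] (P : PrimeSpectrum A) :
    ∃ a ∉ P.asIdeal, ∀ (A' : Type u) [CommRing A'] [Algebra k A'] [Algebra A A']
      [IsScalarTower k A A'] [IsLocalization.Away a A'], Module.Free A' (Ω[A'⁄k]) := by
  have h : P ∈ Module.freeLocus A (Ω[A⁄k]) := by rw [Module.freeLocus_eq_univ]; trivial
  rw [Module.mem_freeLocus] at h
  obtain ⟨a, ha, h1, -⟩ := Module.FinitePresentation.exists_free_localizedModule_powers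
    P.asIdeal.primeCompl (LocalizedModule.mkLinearMap P.asIdeal.primeCompl (Ω[A⁄k]))
    (Localization.AtPrime P.asIdeal)
  refine ⟨a, ha, fun A' _ _ _ _ _ ↦ ?_⟩
  exact free_of_isLocalizedModule (Submonoid.powers a) A' _ (KaehlerDifferential.map k k A A') h1

end Free

/-! ### Sections over affine opens inside the function field. -/

section Sections

variable {k : Type u} [Field k] {X : Scheme.{u}} (f : X ⟶ Spec (CommRingCat.of k))

instance secAlgebra [IsIntegral X] (U : X.Opens) [Nonempty U] : Algebra (Sec f U) (FunField f) :=
  inferInstanceAs (Algebra Γ(X, U) X.functionField)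

theorem algebraMap_res [IsIntegral X] {U V : X.Opens} [Nonempty U] [Nonempty V] (h : V ≤ U)
    (s : Sec f U) : algebraMap (Sec f V) (FunField f) (res f h s) =
      algebraMap (Sec f U) (FunField f) s :=
  TopCat.Presheaf.germ_res_apply X.presheaf (homOfLE h) _ _ _

instance [IsIntegral X] (U : X.Opens) [Nonempty U] : IsScalarTower k (Sec f U) (FunField f) :=
  .of_algebraMap_eq fun c ↦ by
    have : Nonempty (⊤ : X.Opens) := ⟨⟨genericPoint X, trivial⟩⟩
    rw [← (res f (le_top : U ≤ ⊤)).commutes c, algebraMap_res]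
    rfl

instance [IsIntegral X] (U : X.Opens) [Nonempty U] : IsDomain (Sec f U) :=
  inferInstanceAs (IsDomain Γ(X, U))

theorem isFractionRing_sec [IsIntegral X] {U : X.Opens} (hU : IsAffineOpen U) [Nonempty U] :
    IsFractionRing (Sec f U) (FunField f) :=
  _root_.AlgebraicGeometry.functionField_isFractionRing_of_isAffineOpen (X := X) U hU

theorem algebraMap_sec_injective [IsIntegral X] (U : X.Opens) [Nonempty U] :
    Function.Injective (algebraMap (Sec f U) (FunField f)) :=
  Scheme.germToFunctionField_injective (X := X) U

theorem smooth_sec [Smooth f] {U : X.Opens} (hU : IsAffineOpen U) : Algebra.Smooth k (Sec f U) := by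
  have h : (structMap f U).Smooth := by
    refine RingHom.Smooth.comp ?_ (f.smooth_appLE (isAffineOpen_top _) hU _)
    exact RingHom.Smooth.of_bijective
      (Scheme.ΓSpecIso (CommRingCat.of k)).symm.commRingCatIsoToRingEquiv.bijective
  exact h

theorem essFiniteType_funField [IsIntegral X] [Smooth f] :
    Algebra.EssFiniteType k (FunField f) := by
  obtain ⟨_, ⟨U, hU, rfl⟩, hx, -⟩ := X.isBasis_affineOpens.exists_subset_of_mem_open
    (Set.mem_univ (genericPoint X)) isOpen_univ
  have : Nonempty U := ⟨⟨_, hx⟩⟩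
  have := smooth_sec f hU
  have := isFractionRing_sec f hU
  have : Algebra.EssFiniteType (Sec f U) (FunField f) :=
    .of_isLocalization _ (nonZeroDivisors (Sec f U))
  exact .comp k (Sec f U) (FunField f)

theorem finrank_kaehler_sec [IsIntegral X] {U : X.Opens} (hU : IsAffineOpen U) [Nonempty U]
    [Module.Free (Sec f U) (Ω[Sec f U⁄k])] :
    Module.finrank (Sec f U) (Ω[Sec f U⁄k]) = rankOmega f := by
  have := isFractionRing_sec f hU
  rw [rankOmega]
  have : Algebra.FormallyEtale (Sec f U) (FunField f) :=
    .of_isLocalization (nonZeroDivisors (Sec f U))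
  rw [← (KaehlerDifferential.isBaseChange_of_formallyEtale k (Sec f U)
    (FunField f)).equiv.finrank_eq,
    Module.finrank_baseChange]

/-- Affine opens have elements whose differentials form a basis of the differentials of the function
field. -/
theorem exists_basis_kaehler [IsIntegral X] [Smooth f] {U : X.Opens} (hU : IsAffineOpen U)
    [Nonempty U] : ∃ (e : Module.Basis (Fin (rankOmega f)) (FunField f) (Ω[FunField f⁄k]))
      (x : Fin (rankOmega f) → Sec f U),
      ∀ i, e i = KaehlerDifferential.D k _ (algebraMap _ (FunField f) (x i)) := by
  have := isFractionRing_sec f hU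
  have := essFiniteType_funField f
  have h := KaehlerDifferential.span_range_map_derivation_of_isLocalization k (Sec f U) (FunField f)
    (nonZeroDivisors (Sec f U))
  let b := Module.Basis.ofSpan h.ge
  have hfin := Module.Finite.finite_basis b
  let b' := b.reindex (Finite.equivFinOfCardEq (Module.finrank_eq_nat_card_basis b).symm)
  have hb : ∀ i, ∃ x : Sec f U,
      KaehlerDifferential.D k _ (algebraMap _ (FunField f) x) = b' i := fun i ↦ by
    obtain ⟨x, hx⟩ := Module.Basis.ofSpan_subset h.ge
      ⟨(Finite.equivFinOfCardEq (Module.finrank_eq_nat_card_basis b).symm).symm i, rfl⟩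
    refine ⟨x, ?_⟩
    rw [Function.comp_apply, KaehlerDifferential.map_D] at hx
    rw [hx, Module.Basis.reindex_apply]
  choose x hx using hb
  exact ⟨b', x, fun i ↦ (hx i).symm⟩

end Sections

/-! ### Restriction of the lifting data to smaller opens. -/

section Restriction

variable {p : ℕ} [hp : Fact p.Prime] {k : Type u} [Field k] [CharP k p] [PerfectRing k p]
  {X Y : Scheme.{u}} {f : X ⟶ Spec (CommRingCat.of k)}
  {g : Y ⟶ Spec (CommRingCat.of (TruncatedWittVector p 2 k))} [Flat g] {i : X ⟶ Y} {FY : Y ⟶ Y}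
  (hpb : IsPullback i f g (Spec.map (CommRingCat.ofHom (wittResidue p k))))
  (hF : i ≫ FY = absFrobenius p f ≫ i)

theorem liftData_proj_map {V V' : Y.Opens} (hV : IsAffineOpen V) (hV' : IsAffineOpen V')
    (h : V' ≤ V) (h' : i ⁻¹ᵁ V' ≤ i ⁻¹ᵁ V) (b : Γ(Y, V)) :
    (liftData hpb hF V' hV').proj ((Y.presheaf.map (homOfLE h).op).hom b) =
      res f h' ((liftData hpb hF V hV).proj b) :=
  congrArg (fun F ↦ F.hom b) (i.naturality (homOfLE h).op)

theorem liftData_frob_map {V V' : Y.Opens} (hV : IsAffineOpen V) (hV' : IsAffineOpen V')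
    (h : V' ≤ V) (b : Γ(Y, V)) :
    (liftData hpb hF V' hV').frob ((Y.presheaf.map (homOfLE h).op).hom b) =
      (Y.presheaf.map (homOfLE h).op).hom ((liftData hpb hF V hV).frob b) := by
  have h1 := (FY.map_appLE (le_preimage_of_comp_eq hpb hF V') (homOfLE h).op).trans
    (FY.appLE_map (le_preimage_of_comp_eq hpb hF V) (homOfLE h).op).symm
  exact congrArg (fun F ↦ F.hom b) h1

omit [CharP k p] [PerfectRing k p] [Flat g] in
theorem isAffineOpen_preimage
    (hpb : IsPullback i f g (Spec.map (CommRingCat.ofHom (wittResidue p k))))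
    {V : Y.Opens} (hV : IsAffineOpen V) : IsAffineOpen (i ⁻¹ᵁ V) := by
  have := isClosedImmersion_of_isPullback hpb
  exact hV.preimage i

omit [CharP k p] [PerfectRing k p] [Flat g] in
/-- The affine opens over which the differentials are free form a cover. -/
theorem exists_affine_free [Smooth f]
    (hpb : IsPullback i f g (Spec.map (CommRingCat.ofHom (wittResidue p k))))
    (x : X) : ∃ V : Y.Opens, IsAffineOpen V ∧
    x ∈ i ⁻¹ᵁ V ∧ Module.Free (Sec f (i ⁻¹ᵁ V)) (Ω[Sec f (i ⁻¹ᵁ V)⁄k]) := by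
  obtain ⟨V, hV, hx⟩ : ∃ V : Y.Opens, IsAffineOpen V ∧ i x ∈ V := by
    obtain ⟨_, ⟨V, hV, rfl⟩, hx, -⟩ := Y.isBasis_affineOpens.exists_subset_of_mem_open
      (Set.mem_univ (i x)) isOpen_univ
    exact ⟨V, hV, hx⟩
  have hU := isAffineOpen_preimage hpb hV
  have := smooth_sec f hU
  have := Module.finitePresentation_of_projective (Sec f (i ⁻¹ᵁ V)) (Ω[Sec f (i ⁻¹ᵁ V)⁄k])
  have hfree := exists_free_kaehler (k := k) (A := Sec f (i ⁻¹ᵁ V))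
  obtain ⟨a, ha, h⟩ := hfree (hU.primeIdealOf ⟨x, hx⟩)
  have := isClosedImmersion_of_isPullback hpb
  -- The localizing function is lifted to `Y`, since lifting data exist only over opens of the form
  -- `i ⁻¹ᵁ V`.
  obtain ⟨b, rfl⟩ := i.app_surjective V hV a
  refine ⟨Y.basicOpen b, hV.basicOpen b, ?_, ?_⟩
  · have hx' : x ∈ i ⁻¹ᵁ V := hx
    rw [Scheme.preimage_basicOpen, Scheme.mem_basicOpen (hx := hx')]
    rw [hU.primeIdealOf_eq_map_closedPoint] at ha
    exact not_not.mp ha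
  · have key : ∀ U : X.Opens, U = X.basicOpen (i.app V b) →
        Module.Free (Sec f U) (Ω[Sec f U⁄k]) := by
      rintro _ rfl
      let φ := res f (X.basicOpen_le (i.app V b))
      let _ : Algebra (Sec f (i ⁻¹ᵁ V)) (Sec f (X.basicOpen (i.app V b))) := φ.toRingHom.toAlgebra
      have : IsScalarTower k (Sec f (i ⁻¹ᵁ V)) (Sec f (X.basicOpen (i.app V b))) :=
        .of_algebraMap_eq' φ.comp_algebraMap.symm
      have : IsLocalization.Away (show Sec f (i ⁻¹ᵁ V) from i.app V b)
        (Sec f (X.basicOpen (i.app V b))) := hU.isLocalization_basicOpen (i.app V b)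
      exact h _
    exact key _ (Scheme.preimage_basicOpen ..)

end Restriction

/-! ### Everywhere regular rational functions are constant. -/

section Descent

variable {k : Type u} [Field k] {X : Scheme.{u}} (f : X ⟶ Spec (CommRingCat.of k))

/-- A rational function which is regular everywhere on a proper integral scheme over an
algebraically closed field is constant. -/
theorem exists_algebraMap_eq_of_regular [IsAlgClosed k] [IsIntegral X] [IsProper f] (y : FunField f)
    (h : ∀ x : X, ∃ U : X.Opens, x ∈ U ∧ ∃ (_ : Nonempty U) (c : Sec f U),
      algebraMap (Sec f U) (FunField f) c = y) : ∃ c : k, algebraMap k (FunField f) c = y := by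
  choose U hxU hU c hc using h
  have hcover : (⊤ : X.Opens) ≤ iSup U := fun x _ ↦ TopologicalSpace.Opens.mem_iSup.mpr ⟨x, hxU x⟩
  obtain ⟨s, hs⟩ : ∃ s : Sec f ⊤, ∀ x, res f (le_top : U x ≤ ⊤) s = c x := by
    obtain ⟨s, hs, -⟩ := X.sheaf.existsUnique_gluing' U ⊤ (fun x ↦ homOfLE le_top) hcover
      (fun x ↦ (c x : Γ(X, U x))) (fun x x' ↦ by
      have : Nonempty (U x ⊓ U x' : X.Opens) := by
        obtain ⟨z, hz⟩ := (PreirreducibleSpace.isPreirreducible_univ (X := X)) _ _ (U x).2 (U x').2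
          ⟨x, trivial, hxU x⟩ ⟨x', trivial, hxU x'⟩
        exact ⟨z, hz.2⟩
      refine algebraMap_sec_injective f (U x ⊓ U x') ?_
      change algebraMap (Sec f (U x ⊓ U x')) (FunField f) (res f inf_le_left (c x)) =
        algebraMap (Sec f (U x ⊓ U x')) (FunField f) (res f inf_le_right (c x'))
      rw [algebraMap_res, algebraMap_res, hc, hc])
    exact ⟨s, hs⟩
  have : Nonempty (⊤ : X.Opens) := ⟨⟨genericPoint X, trivial⟩⟩
  have hs' : algebraMap (Sec f ⊤) (FunField f) s = y := by
    rw [← hc (genericPoint X), ← hs, algebraMap_res]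
  -- Properness makes the global functions integral over `k`; they form a domain and `k` is
  -- algebraically closed, so they are constants.
  have hint : Algebra.IsIntegral k (Sec f ⊤) := by
    have h1 : (structMap f ⊤).IsIntegral := by
      refine RingHom.IsIntegral.trans _ _ ?_ ?_
      · exact RingHom.isIntegral_of_surjective _
          (Scheme.ΓSpecIso (CommRingCat.of k)).symm.commRingCatIsoToRingEquiv.surjective
      · have h2 : f.appLE ⊤ ⊤ (le_preimage_top f ⊤) = f.appTop := Scheme.Hom.appLE_eq_app _
        rw [h2]
        exact isIntegral_appTop_of_universallyClosed f
    exact ⟨h1⟩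
  obtain ⟨d, hd⟩ := IsAlgClosed.algebraMap_bijective_of_isIntegral (k := k) (K := Sec f ⊤) |>.2 s
  exact ⟨d, by rw [IsScalarTower.algebraMap_apply k (Sec f ⊤), hd, hs']⟩

end Descent

/-! ### The map `dF/p` on the differentials of the function field. -/

section Semilinear

variable {p : ℕ} [hp : Fact p.Prime] {k : Type u} [Field k] [CharP k p] [PerfectRing k p]
  {X Y : Scheme.{u}} [IsIntegral X] {f : X ⟶ Spec (CommRingCat.of k)}
  {g : Y ⟶ Spec (CommRingCat.of (TruncatedWittVector p 2 k))} [Flat g] {i : X ⟶ Y} {FY : Y ⟶ Y}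
  (hpb : IsPullback i f g (Spec.map (CommRingCat.ofHom (wittResidue p k))))
  (hF : i ≫ FY = absFrobenius p f ≫ i)

/-- The differential of the lifting of the Frobenius, divided by `p`, as a map from the functions on
an affine open to the differentials of the function field. -/
def fracDer (V : Y.Opens) (hV : IsAffineOpen V) [Nonempty (i ⁻¹ᵁ V)] (a : Sec f (i ⁻¹ᵁ V)) :
    Ω[FunField f⁄k] :=
  KaehlerDifferential.map k k (Sec f (i ⁻¹ᵁ V)) (FunField f) ((liftData hpb hF V hV).der k a)

theorem fracDer_mul (V : Y.Opens) (hV : IsAffineOpen V) [Nonempty (i ⁻¹ᵁ V)]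
    (a b : Sec f (i ⁻¹ᵁ V)) : fracDer hpb hF V hV (a * b) =
      algebraMap _ (FunField f) a ^ p • fracDer hpb hF V hV b +
        algebraMap _ (FunField f) b ^ p • fracDer hpb hF V hV a := by
  rw [fracDer, ((liftData hpb hF V hV).isFrobDer_der k).map_mul, map_add, map_smul, map_smul,
    ← map_pow, ← map_pow, algebraMap_smul, algebraMap_smul]
  rfl

theorem fracDer_res {V V' : Y.Opens} (hV : IsAffineOpen V) (hV' : IsAffineOpen V') (h : V' ≤ V)
    [Nonempty (i ⁻¹ᵁ V)] [Nonempty (i ⁻¹ᵁ V')] (h' : i ⁻¹ᵁ V' ≤ i ⁻¹ᵁ V)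
    (a : Sec f (i ⁻¹ᵁ V)) :
    fracDer hpb hF V' hV' (res f h' a) = fracDer hpb hF V hV a := by
  let _ : Algebra (Sec f (i ⁻¹ᵁ V)) (Sec f (i ⁻¹ᵁ V')) := (res f h').toRingHom.toAlgebra
  have : IsScalarTower k (Sec f (i ⁻¹ᵁ V)) (Sec f (i ⁻¹ᵁ V')) :=
    .of_algebraMap_eq' (res f h').comp_algebraMap.symm
  have : IsScalarTower (Sec f (i ⁻¹ᵁ V)) (Sec f (i ⁻¹ᵁ V')) (FunField f) :=
    .of_algebraMap_eq fun a ↦ (algebraMap_res f h' a).symm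
  have h1 := (liftData hpb hF V hV).map_der k (liftData hpb hF V' hV')
    (Y.presheaf.map (homOfLE h).op).hom (liftData_proj_map hpb hF hV hV' h h')
    (liftData_frob_map hpb hF hV hV' h) a
  have h2 := congrArg (KaehlerDifferential.map k k (Sec f (i ⁻¹ᵁ V')) (FunField f)) h1
  rw [kaehlerMap_kaehlerMap] at h2
  exact h2

variable (ξ : Ω[FunField f⁄k] →+ Ω[FunField f⁄k])

theorem semilinear_eq_fracDer_of_le {V V' : Y.Opens} (hV : IsAffineOpen V) (hV' : IsAffineOpen V')
    (h : V' ≤ V) [Nonempty (i ⁻¹ᵁ V)] [Nonempty (i ⁻¹ᵁ V')]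
    (hξ : ∀ a, ξ (KaehlerDifferential.D k _ (algebraMap (Sec f (i ⁻¹ᵁ V')) (FunField f) a)) =
      fracDer hpb hF V' hV' a) (a : Sec f (i ⁻¹ᵁ V)) :
    ξ (KaehlerDifferential.D k _ (algebraMap _ (FunField f) a)) = fracDer hpb hF V hV a := by
  have h' : i ⁻¹ᵁ V' ≤ i ⁻¹ᵁ V := fun x hx ↦ h hx
  rw [← fracDer_res hpb hF hV hV' h h', ← hξ, algebraMap_res]

/-- A function on the smaller open is a quotient of functions on the larger one, and the twisted
Leibniz rule fixes a Frobenius derivation on quotients. -/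
theorem semilinear_eq_fracDer_of_ge (hs : ∀ (c : FunField f) w, ξ (c • w) = c ^ p • ξ w)
    {V V' : Y.Opens} (hV : IsAffineOpen V) (hV' : IsAffineOpen V')
    (h : V' ≤ V) [Nonempty (i ⁻¹ᵁ V)] [Nonempty (i ⁻¹ᵁ V')]
    (hξ : ∀ a, ξ (KaehlerDifferential.D k _ (algebraMap (Sec f (i ⁻¹ᵁ V)) (FunField f) a)) =
      fracDer hpb hF V hV a) (a : Sec f (i ⁻¹ᵁ V')) :
    ξ (KaehlerDifferential.D k _ (algebraMap _ (FunField f) a)) = fracDer hpb hF V' hV' a := by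
  have h' : i ⁻¹ᵁ V' ≤ i ⁻¹ᵁ V := fun x hx ↦ h hx
  have := charP_of_injective_algebraMap (algebraMap k (FunField f)).injective p
  have := isFractionRing_sec f (isAffineOpen_preimage hpb hV)
  have hr : ∀ b : Sec f (i ⁻¹ᵁ V), ξ (KaehlerDifferential.D k _
      (algebraMap _ (FunField f) (res f h' b))) = fracDer hpb hF V' hV' (res f h' b) := fun b ↦ by
    rw [fracDer_res hpb hF hV hV' h h', algebraMap_res, hξ]
  obtain ⟨b, s, hs0, hbs⟩ := IsFractionRing.div_surjective (A := Sec f (i ⁻¹ᵁ V))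
    (algebraMap _ (FunField f) a)
  have hs1 : algebraMap _ (FunField f) s ≠ 0 :=
    (map_ne_zero_iff _ (algebraMap_sec_injective f _)).mpr (nonZeroDivisors.ne_zero hs0)
  have hb : a * res f h' s = res f h' b := algebraMap_sec_injective f _ (by
    rw [map_mul, algebraMap_res, algebraMap_res, ← hbs, div_mul_cancel₀ _ hs1])
  refine IsFrobDer.eq_of_mul_eq (p := p) (K := FunField f) (algebraMap_sec_injective f (i ⁻¹ᵁ V'))
    (D := fun a ↦ ξ (KaehlerDifferential.D k _ (algebraMap _ (FunField f) a)))
    (s := res f h' s) ?_ (fracDer_mul hpb hF V' hV') ?_ (hr s) (hb ▸ hr b)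
  · intro a b
    rw [map_mul, Derivation.leibniz, map_add, hs, hs]
  · rw [← map_ne_zero_iff _ (algebraMap_sec_injective f (i ⁻¹ᵁ V')), algebraMap_res]
    exact hs1

/-- The differential of the lifting of the Frobenius, divided by `p`, as a semilinear endomorphism
of the differentials of the function field. -/
theorem exists_semilinear_eq_fracDer [Smooth f] :
    ∃ (e : Module.Basis (Fin (rankOmega f)) (FunField f) (Ω[FunField f⁄k]))
      (ξ : Ω[FunField f⁄k] →+ Ω[FunField f⁄k]),
      (∀ (c : FunField f) w, ξ (c • w) = c ^ p • ξ w) ∧ e.det (ξ ∘ e) ≠ 0 ∧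
      ∀ (V : Y.Opens) (hV : IsAffineOpen V) (_ : Nonempty (i ⁻¹ᵁ V)) (a : Sec f (i ⁻¹ᵁ V)),
        ξ (KaehlerDifferential.D k _ (algebraMap _ (FunField f) a)) = fracDer hpb hF V hV a := by
  have := charP_of_injective_algebraMap (algebraMap k (FunField f)).injective p
  have := essFiniteType_funField f
  have hbasis : ∀ (x : X) (W : Y.Opens), x ∈ i ⁻¹ᵁ W →
      ∃ V : Y.Opens, IsAffineOpen V ∧ x ∈ i ⁻¹ᵁ V ∧ V ≤ W := fun x W hx ↦ by
    obtain ⟨_, ⟨V, hV, rfl⟩, hx, h⟩ := Y.isBasis_affineOpens.exists_subset_of_mem_open hx W.2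
    exact ⟨V, hV, hx, h⟩
  obtain ⟨V₀, hV₀, hx₀, -⟩ := hbasis (genericPoint X) ⊤ trivial
  have : Nonempty (i ⁻¹ᵁ V₀) := ⟨⟨_, hx₀⟩⟩
  have := isFractionRing_sec f (isAffineOpen_preimage hpb hV₀)
  obtain ⟨e, x, he⟩ := exists_basis_kaehler f (isAffineOpen_preimage hpb hV₀)
  obtain ⟨ξ, hξ, hξ₀⟩ := exists_semilinear (K := FunField f) (p := p)
    (fun c : k ↦ by obtain ⟨d, hd⟩ := surjective_frobenius k p c; exact ⟨d, hd.symm⟩)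
    _ ((liftData hpb hF V₀ hV₀).isFrobDer_der k)
  refine ⟨e, ξ, hξ, ?_, fun V hV hne ↦ ?_⟩
  · have h1 : ∀ j, ∃ y, x j = (liftData hpb hF V₀ hV₀).proj y := fun j ↦ by
      obtain ⟨y, hy⟩ := (liftData hpb hF V₀ hV₀).proj_surjective (x j)
      exact ⟨y, hy.symm⟩
    choose y hy using h1
    convert det_pow_smul_add_ne_zero (p := p) (fun j ↦ algebraMap _ (FunField f) (x j)) e he
      (fun j ↦ algebraMap _ (FunField f) ((liftData hpb hF V₀ hV₀).δ (y j))) using 2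
    ext1 j
    rw [Function.comp_apply, he, hξ₀]
    conv_lhs => rw [hy j, LiftData.der_proj, map_add, map_smul, KaehlerDifferential.map_D,
      KaehlerDifferential.map_D, ← hy j, ← algebraMap_smul (FunField f), map_pow]
  -- The map `ξ` was built from `V₀` alone; the formula passes to `V` through an affine open inside
  -- `V₀ ⊓ V`, whose preimage is nonempty because `X` is irreducible.
  · obtain ⟨z, hz⟩ := (PreirreducibleSpace.isPreirreducible_univ (X := X)) _ _ (i ⁻¹ᵁ V₀).2
      (i ⁻¹ᵁ V).2 ⟨_, trivial, hx₀⟩ (by obtain ⟨z, hz⟩ := hne; exact ⟨z, trivial, hz⟩)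
    obtain ⟨V', hV', hz', hle⟩ := hbasis z (V₀ ⊓ V) hz.2
    have : Nonempty (i ⁻¹ᵁ V') := ⟨⟨z, hz'⟩⟩
    exact semilinear_eq_fracDer_of_le hpb hF ξ hV hV' (hle.trans inf_le_right)
      (semilinear_eq_fracDer_of_ge hpb hF ξ hξ hV₀ hV' (hle.trans inf_le_left) hξ₀)

end Semilinear

/-! ### Generic values of pluricanonical forms. -/

section Canonical

variable {k : Type u} [Field k] {X : Scheme.{u}} [IsIntegral X] {f : X ⟶ Spec (CommRingCat.of k)}
  (e : Module.Basis (Fin (rankOmega f)) (FunField f) (Ω[FunField f⁄k]))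

/-- The value of a pluricanonical form at the generic point does not depend on the affine open. -/
theorem toPoly_eq_toPoly {m : ℕ} {s : ∀ U : X.affineOpens, PluriForms k (rankOmega f) (Sec f U)}
    (hs : s ∈ pluricanonical f m) (U V : X.affineOpens) [hU : Nonempty U.1] [hV : Nonempty V.1] :
    toPoly (Sec f U) e (s U) = toPoly (Sec f V) e (s V) := by
  obtain ⟨z, hz⟩ := (PreirreducibleSpace.isPreirreducible_univ (X := X)) _ _ U.1.2 V.1.2
      (by obtain ⟨z, hz⟩ := hU; exact ⟨z, trivial, hz⟩)
      (by obtain ⟨z, hz⟩ := hV; exact ⟨z, trivial, hz⟩)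
  obtain ⟨_, ⟨W, hW, rfl⟩, hz, h⟩ := X.isBasis_affineOpens.exists_subset_of_mem_open
    (show z ∈ (U.1 ⊓ V.1 : X.Opens) from hz.2) (U.1 ⊓ V.1).2
  let W' : X.affineOpens := ⟨W, hW⟩
  have : Nonempty W'.1 := ⟨⟨z, hz⟩⟩
  have hWU : (W' : X.Opens) ≤ U := fun x hx ↦ (h hx).1
  have hWV : (W' : X.Opens) ≤ V := fun x hx ↦ (h hx).2
  have h1 := hs.2 U W' hWU
  have h2 := hs.2 V W' hWV
  rw [← toPoly_pluriFormsMap e (res f hWU) (algebraMap_res f hWU), h1, ← h2,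
    toPoly_pluriFormsMap e (res f hWV) (algebraMap_res f hWV)]

theorem toPoly_injective_sec [Smooth f] (U : X.affineOpens) [Nonempty U.1] :
    Function.Injective (toPoly (Sec f U) e) := by
  have := smooth_sec f U.2
  have := isFractionRing_sec f U.2
  exact toPoly_injective e

end Canonical

/-! ### The canonical ring and its transcendence degree. -/

/-- Powers of the values of pluricanonical forms at the generic point are proportional to powers of
a fixed function. -/
theorem exists_pow_mul_pow_eq {p : ℕ} [hp : Fact p.Prime] {k : Type u} [Field k] [IsAlgClosed k]
    [CharP k p] {X : Scheme.{u}} [IsIntegral X] {f : X ⟶ Spec (CommRingCat.of k)} [IsProper f]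
    [Smooth f] (h : FrobeniusLifts p f) :
    ∃ (e : Module.Basis (Fin (rankOmega f)) (FunField f) (Ω[FunField f⁄k])) (d : FunField f),
      d ≠ 0 ∧ ∀ m, ∀ s ∈ pluricanonical f m, ∀ (U : X.affineOpens) (_ : Nonempty U.1) a,
        toPoly (Sec f U) e (s U) = Polynomial.monomial m a →
        ∃ c : k, algebraMap k _ c = a ^ (p - 1) * d ^ m := by
  obtain ⟨Y, g, i, FY, hg, hpb, hF⟩ := h
  obtain ⟨e, ξ, hξ, hdet, hξV⟩ := exists_semilinear_eq_fracDer hpb hF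
  have := charP_of_injective_algebraMap (algebraMap k (FunField f)).injective p
  refine ⟨e, _, hdet, fun m s hs U _ a ha ↦ ?_⟩
  refine exists_algebraMap_eq_of_regular f _ fun x ↦ ?_
  obtain ⟨V, hV, hx, hfree⟩ := exists_affine_free hpb x
  have hU := isAffineOpen_preimage hpb hV
  have hne : Nonempty (i ⁻¹ᵁ V) := ⟨⟨x, hx⟩⟩
  have := smooth_sec f hU
  let b := (Module.finBasis (Sec f (i ⁻¹ᵁ V)) (Ω[Sec f (i ⁻¹ᵁ V)⁄k])).reindex
    (finCongr (finrank_kaehler_sec f hU))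
  let U' : X.affineOpens := ⟨i ⁻¹ᵁ V, hU⟩
  have hne' : Nonempty U'.1 := hne
  have ha' : toPoly (Sec f (i ⁻¹ᵁ V)) e (s U') = Polynomial.monomial m a :=
    (toPoly_eq_toPoly e hs U' U).trans ha
  obtain ⟨c, hc⟩ := exists_eq_pow_mul_pow e ξ hξ (fun a ↦ ⟨_, hξV V hV hne a⟩) b (hs.1 U') ha'
  exact ⟨i ⁻¹ᵁ V, hx, hne, c, hc⟩

/-- `R` embeds into the integral closure of `k[τ]` in `S`; this has the transcendence degree of
`k[τ]`, a quotient of a polynomial ring in one variable. -/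
theorem trdeg_le_one_of_isIntegral {k R S : Type u} [Field k] [CommRing R] [CommRing S] [IsDomain S]
    [Algebra k R] [Algebra k S] (Φ : R →ₐ[k] S) (hΦ : Function.Injective Φ) (τ : S)
    (h : ∀ r, IsIntegral (Algebra.adjoin k {τ}) (Φ r)) : Algebra.trdeg k R ≤ 1 := by
  let T := Algebra.adjoin k {τ}
  let C : Subalgebra k S := (integralClosure T S).restrictScalars k
  let _ : Algebra T C := (integralClosure T S).algebra
  have : IsScalarTower k T C := .of_algebraMap_eq fun _ ↦ rfl
  have : Algebra.IsIntegral T C := inferInstanceAs (Algebra.IsIntegral T (integralClosure T S))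
  have : FaithfulSMul T C := (faithfulSMul_iff_algebraMap_injective T C).mpr fun x y hxy ↦
    Subtype.ext (congrArg (fun z : C ↦ (z : S)) hxy)
  have h1 : Algebra.trdeg k R ≤ Algebra.trdeg k C :=
    trdeg_le_of_injective (Φ.codRestrict C h) fun x y hxy ↦ hΦ (congrArg Subtype.val hxy)
  have h2 : Algebra.trdeg k T ≤ 1 := by
    rw [← Polynomial.trdeg_of_isDomain (R := k)]
    have hT : T = (Polynomial.aeval (R := k) τ).range := Algebra.adjoin_singleton_eq_range_aeval k τ
    rw [(Subalgebra.equivOfEq _ _ hT).trdeg_eq]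
    exact trdeg_le_of_surjective _ (Polynomial.aeval (R := k) τ).rangeRestrict_surjective
  rw [← trdeg_add_eq k T (A := C), trdeg_eq_zero (R := T), add_zero] at h1
  exact h1.trans h2

theorem isIntegral_adjoin_of_pow_eq_smul {k S : Type*} [CommRing k] [CommRing S] [Algebra k S]
    {x τ : S} {c : k} {n m : ℕ} (hn : 0 < n) (h : x ^ n = c • τ ^ m) :
    IsIntegral (Algebra.adjoin k {τ}) x := by
  refine IsIntegral.of_pow hn ?_
  rw [h]
  have h1 : c • τ ^ m ∈ Algebra.adjoin k {τ} :=
    Subalgebra.smul_mem _ (pow_mem (Algebra.subset_adjoin (Set.mem_singleton τ)) m) c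
  exact isIntegral_algebraMap (R := Algebra.adjoin k {τ}) (x := ⟨_, h1⟩)

variable {k : Type u} [Field k] {X : Scheme.{u}} [IsIntegral X] {f : X ⟶ Spec (CommRingCat.of k)}
  (e : Module.Basis (Fin (rankOmega f)) (FunField f) (Ω[FunField f⁄k]))

/-- The values of pluricanonical forms at the generic point, computed on an affine open. -/
def canonicalToPoly (U : X.affineOpens) [Nonempty U.1] :
    CanonicalRing f →ₐ[k] Polynomial (FunField f) :=
  ((toPoly (Sec f U) e).restrictScalars k).comp
    ((Pi.evalAlgHom k (fun U : X.affineOpens ↦ PluriForms k (rankOmega f) (Sec f U)) U).comp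
      (DirectSum.coeAlgHom (pluricanonical f)))

theorem canonicalToPoly_of (U : X.affineOpens) [Nonempty U.1] (m : ℕ) (s : pluricanonical f m) :
    canonicalToPoly e U (DirectSum.of (fun m ↦ pluricanonical f m) m s) =
      toPoly (Sec f U) e (s.1 U) :=
  congrArg (fun F ↦ toPoly (Sec f U) e (F U)) (DirectSum.coeAlgHom_of (pluricanonical f) m s)

theorem eq_zero_of_toPoly_eq_zero [Smooth f] {m : ℕ}
    {s : ∀ U : X.affineOpens, PluriForms k (rankOmega f) (Sec f U)}
    (hs : s ∈ pluricanonical f m) (U : X.affineOpens) [Nonempty U.1]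
    (h : toPoly (Sec f U) e (s U) = 0) : s = 0 := by
  funext V
  by_cases hV : Nonempty V.1
  · refine toPoly_injective_sec e V ?_
    rw [toPoly_eq_toPoly e hs V U, h, Pi.zero_apply, map_zero]
  -- The families also have a component at the empty affine open, where the ring of sections is
  -- zero.
  · have h1 : V.1 = ⊥ := by
      ext x
      exact ⟨fun hx ↦ hV ⟨⟨x, hx⟩⟩, fun hx ↦ hx.elim⟩
    have h2 : Subsingleton (Sec f V) := by
      rw [h1]
      exact inferInstanceAs (Subsingleton Γ(X, ⊥))
    have := Module.subsingleton (Sec f V) (PluriForms k (rankOmega f) (Sec f V))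
    exact Subsingleton.elim _ _

/-- Components of different degrees `m` land in different powers of the variable, so each one can be
read off as a coefficient. -/
theorem canonicalToPoly_injective [Smooth f] (U : X.affineOpens) [Nonempty U.1] :
    Function.Injective (canonicalToPoly e U) := by
  rw [injective_iff_map_eq_zero]
  classical
  intro x hx
  have h : ∀ m, ∃ a, toPoly (Sec f U) e ((x m).1 U) = Polynomial.monomial m a := fun m ↦
    toPoly_mem e ((x m).2.1 U)
  choose a ha using h
  have hsum : canonicalToPoly e U x = ∑ m ∈ DFinsupp.support x, Polynomial.monomial m (a m) := by
    conv_lhs => rw [← DirectSum.sum_support_of x, map_sum]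
    exact Finset.sum_congr rfl fun m _ ↦ by rw [canonicalToPoly_of, ha]
  refine DFinsupp.ext fun m ↦ Subtype.ext (eq_zero_of_toPoly_eq_zero e (x m).2 U ?_)
  rw [ha]
  by_cases hm : m ∈ DFinsupp.support x
  · have h1 := congrArg (fun P ↦ P.coeff m) (hsum.symm.trans hx)
    simp only [Polynomial.finsetSum_coeff, Polynomial.coeff_monomial, Polynomial.coeff_zero,
      Finset.sum_ite_eq', hm, if_true] at h1
    rw [h1, map_zero]
  · rw [← ha, DFinsupp.notMem_support_iff.mp hm]
    exact map_zero _

/-- If the Frobenius lifts to `W₂(k)`, then the canonical ring has transcendence degree at most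
one. -/
theorem trdeg_canonicalRing_le_one {p : ℕ} [hp : Fact p.Prime] [IsAlgClosed k] [CharP k p]
    [IsProper f] [Smooth f] (h : FrobeniusLifts p f) : Algebra.trdeg k (CanonicalRing f) ≤ 1 := by
  obtain ⟨e, d, hd, hed⟩ := exists_pow_mul_pow_eq h
  obtain ⟨_, ⟨U, hU, rfl⟩, hx, -⟩ := X.isBasis_affineOpens.exists_subset_of_mem_open
    (Set.mem_univ (genericPoint X)) isOpen_univ
  let U' : X.affineOpens := ⟨U, hU⟩
  have hne : Nonempty U'.1 := ⟨⟨_, hx⟩⟩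
  -- With `τ = d⁻¹ T ^ (p - 1)`, the relation `a ^ (p - 1) * d ^ m = c` says `(a T ^ m) ^ (p - 1) =
  -- c τ ^ m`.
  refine trdeg_le_one_of_isIntegral (canonicalToPoly e U') (canonicalToPoly_injective e U')
    (Polynomial.monomial (p - 1) d⁻¹) fun r ↦ ?_
  induction r using DirectSum.induction_on with
  | zero => rw [map_zero]; exact isIntegral_zero
  | add x y hx hy => rw [map_add]; exact hx.add hy
  | of m s =>
    rw [canonicalToPoly_of]
    obtain ⟨a, ha⟩ := toPoly_mem e (s.2.1 U')
    obtain ⟨c, hc⟩ := hed m s.1 s.2 U' hne a ha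
    rw [ha]
    refine isIntegral_adjoin_of_pow_eq_smul (c := c) (m := m) (Nat.sub_pos_of_lt hp.out.one_lt) ?_
    rw [Polynomial.monomial_pow, Polynomial.monomial_pow, mul_comm m, Polynomial.smul_monomial,
      Algebra.smul_def, hc, mul_assoc, ← mul_pow, mul_inv_cancel₀ hd, one_pow, mul_one]

theorem kodairaDim_le_zero (h : Algebra.trdeg k (CanonicalRing f) ≤ 1) : kodairaDim f ≤ 0 := by
  rw [kodairaDim]
  split_ifs
  · exact bot_le
  · have h1 : Cardinal.toENat (Algebra.trdeg k (CanonicalRing f)) ≤ 1 := by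
      rw [← map_one Cardinal.toENat]
      exact OrderHomClass.mono Cardinal.toENat h
    rw [tsub_eq_zero_of_le h1]
    exact le_rfl

end FrobLift

end

theorem mainTheorem3 (p : ℕ) [Fact p.Prime] (k : Type u) [Field k] [IsAlgClosed k] [CharP k p]
    (X : Scheme.{u}) [AlgebraicGeometry.IsIntegral X] (f : X ⟶ Spec (CommRingCat.of k))
    [IsProper f] [Smooth f] (hκ : 1 ≤ FrobLift.kodairaDim f) :
    ¬ FrobLift.FrobeniusLifts p f := fun h ↦
  absurd (hκ.trans (FrobLift.kodairaDim_le_zero (FrobLift.trdeg_canonicalRing_le_one h)))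
    (by decide)
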